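/- **Model.** Consider a time-slotted network with a finite set $\mathcal N$ of $N$ nodes, a set $\mathcal L$ of directed links and a finite set $\mathcal F$ of $K$ flows; flow $c$ has source $b(c)$ and destination $d(c)\neq b(c)$. In slot $t$ the link rates $\mu^c_{mn}(t)\in\{0,1\}$, $(m,n)\in\mathcal L$, form an *activation*: $\mu^c_{m\,b(c)}(t)=0$ for all $m,c$ (no looping back to the source), and $\sum_{c}\big[\sum_i\mu^c_{ni}(t)+\sum_j\mu^c_{jn}(t)\big]\le1$ for every node $n$ (node-exclusive interference). Let $\Lambda\subset\mathbb R^{\mathcal F}$ be the capacity region: the set of $(z_c)$ such that for some integer-valued packet arrival processes at the sources, with long-run average expected rates $z_c$, some sequence of (possibly random) activations makes all node backlogs (started empty) stable, i.e. $\limsup_t\frac1t\sum_{\tau<t}\mathbb E\,U_n^c(\tau)<\infty$. Let $a_c\ge0$, $\varepsilon>0$, and let $(r^*_{\varepsilon,c})$ maximize $\sum_c r_c$ subject to $(r_c+\varepsilon)_c\in\Lambda$ and $r_c\ge a_c$; assume there is $\varepsilon'>0$ with $r^*_{\varepsilon,c}\ge a_c+\varepsilon'$ for all $c$. **Arrivals.**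 Integer numbers $A_c(t)\in[0,\mu_M]$ of packets arrive at the transport layer, where $\mu_M\ge1$; the vectors $(A_c(t))_c$ are i.i.d. in $t$, independent of everything that happened before slot $t$, with means $\lambda_c>r^*_{\varepsilon,c}+\varepsilon$. If $\mu^c_s(t)\in\mathbb Z_{\ge0}$ denotes the number of flow-$c$ packets admitted to $b(c)$ in slot $t$, the transport-layer backlog, with buffer size $L_M\ge0$ and $L_c(0)\in[0,L_M]$, is $L_c(t+1)=\min\{[L_c(t)+A_c(t)-\mu_s^c(t)]^+,L_M\}$. Put $\kappa_c(t)=\min\{L_c(t)+A_c(t),\mu_M\}$. **Queues.** The node backlogs $U^c_n(t)$ are nonnegative integers with $U_n^c(0)=0$, $U^c_{d(c)}(t)=0$ and, for $n\ne d(c)$, $$U^c_n(t+1)\le\Big[U^c_n(t)-\sum_i\mu^c_{ni}(t)\Big]^++\sum_j\mu^c_{jn}(t)+\mathbf 1_{\{n=b(c)\}}\mu_s^c(t).$$ The virtual queues start from $0$ and satisfy $U^c_s(t+1)=[U^c_s(t)-\mu^c_s(t)]^++R_c(t)$, $X_c(t+1)=[X_c(t)-\rho_cR_c(t)]^++\sum_nU_n^c(t)$,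 $Z_c(t+1)=[Z_c(t)-R_c(t)]^++a_c$, $Y_c(t+1)=[Y_c(t)-R_c(t)]^++v_c(t)$. **Algorithm** (parameters $q_M,\eta,V>0$). In each slot: $v_c(t)$ minimizes $v(\eta Y_c(t)-V)$ over $0\le v\le\mu_M$; $R_c(t)$ minimizes $R\big(\frac{q_M-\mu_M}{q_M}U_s^c(t)-\eta Y_c(t)-\rho_cX_c(t)-Z_c(t)\big)$ over $0\le R\le\kappa_c(t)$. For $(m,n)\in\mathcal L$ let $w^c_{mn}=\frac{U^c_s(t)}{q_M}(U^c_m(t)-U^c_n(t))$, let $c^*_{mn}$ be a flow maximizing $w^c_{mn}$ among the flows with $b(c)\ne n$, and let $w_{mn}=[\max_{c:\,b(c)\neq n}w^c_{mn}]^+$ ($0$ if there is no such flow); let $w_c=\big[\frac{U^c_s(t)}{q_M}(q_M-\mu_M-U^c_{b(c)}(t))\big]^+$. The schedule maximizes $\sum_{(m,n)\in\mathcal L}\mu^{c^*_{mn}}_{mn}(t)w_{mn}+\sum_c\mu^c_s(t)w_c$ over activations with $\mu^c_{mn}(t)=0$ for $c\ne c^*_{mn}$ and integers $0\le\mu^c_s(t)\le\kappa_c(t)$,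 and is zero on links and admissions of weight zero. All ties are broken arbitrarily. **Theorem 3.** Suppose $$q_M>\frac{2N-1+\mu_M^2}{2\varepsilon}+\mu_M,\qquad \rho_c>\frac{Nq_M}{r^*_{\varepsilon,c}}\quad\text{for all }c .$$ Let $B=\frac12NKq_M\mu_M+K\frac{q_M-\mu_M}{q_M}\mu_M^2+\frac12\mu_M^2\sum_c\rho_c^2+\frac12KN^2q_M^2+\frac12K\mu_M^2+\frac12K\sum_ca_c^2$ and $B_1=B+K\eta\mu_M^2$. There is a constant $\delta'>0$, depending only on the network and on $\mu_M,q_M,\varepsilon,\varepsilon',\eta,(a_c),(\rho_c),(r^*_{\varepsilon,c})$ (not on $V$, $L_M$ or the law of the processes), such that for all $V>0$ and $L_M\ge0$ all the queues and rates below are integrable and, for every constant $B_R\ge\limsup_{t}\frac1t\sum_{\tau<t}\sum_c\mathbb E R_c(\tau)$ (for example $B_R=K\mu_M$), with $B_2=B_1+VB_R$, $$\limsup_{t\to\infty}\frac1t\sum_{\tau=0}^{t-1}\sum_c\mathbb E\{U^c_s(\tau)+X_c(\tau)+Z_c(\tau)+Y_c(\tau)\}\le\frac{B_2}{\delta'},$$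 and $$\liminf_{t\to\infty}\frac1t\sum_{\tau=0}^{t-1}\sum_c\mathbb E\{v_c(\tau)\}\ge\sum_cr^*_{\varepsilon,c}-\frac{B_1}{V}.$$ -/

import Mathlib

open MeasureTheory ProbabilityTheory Filter

noncomputable section

namespace MultiHop

/-- A multi-hop network with directed links and `Flow`-indexed source/destination pairs. -/
structure Network (Node Flow : Type*) where
  /-- the directed links -/
  links : Set (Node × Node)
  /-- the source node `b(c)` of flow `c` -/
  src : Flow → Node
  /-- the destination node `d(c)` of flow `c` -/
  dst : Flow → Node
  src_ne_dst : ∀ c, src c ≠ dst c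

/-- Time average `(1/t) ∑_{τ < t} f τ`. -/
def timeAvg (f : ℕ → ℝ) (t : ℕ) : ℝ := (1 / (t : ℝ)) * ∑ τ ∈ Finset.range t, f τ

section

variable {Node Flow : Type*} [Fintype Node] [DecidableEq Node] [Fintype Flow]

/-- Link rate assignments `mu c m n` allowed in one slot: they vanish off the links, lie in `{0,1}`,
never loop a flow back to its source, and obey the node-exclusive interference model. -/
structure IsActivation (net : Network Node Flow) (mu : Flow → Node → Node → ℕ) : Prop where
  off_link : ∀ c m n, (m, n) ∉ net.links → mu c m n = 0
  le_one : ∀ c m n, mu c m n ≤ 1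
  no_loop : ∀ c, ∑ m, mu c m (net.src c) = 0
  exclusive : ∀ n, ∑ c, (∑ i, mu c n i + ∑ j, mu c j n) ≤ 1

/-! ### Capacity region -/

/-- Exact backlog update in an uncontrolled network with exogenous packet arrivals `arr c` at the
source of flow `c`.  At most one link at a node is active, so the number of flow-`c` packets really
sent over `(j, n)` is `min (mu c j n) (U c j)`; the subtraction is truncated at zero.  Packets that
reach their destination leave the network. -/
def nextBacklog (net : Network Node Flow) (arr : Flow → ℕ) (mu : Flow → Node → Node → ℕ)
    (U : Flow → Node → ℕ) (c : Flow) (n : Node) : ℕ :=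
  if n = net.dst c then 0
  else (U c n - ∑ i, mu c n i) + ∑ j, min (mu c j n) (U c j)
    + (if n = net.src c then arr c else 0)

/-- Backlogs of the uncontrolled network, started empty. -/
def backlog (net : Network Node Flow) (arr : ℕ → Flow → ℕ) (mu : ℕ → Flow → Node → Node → ℕ) :
    ℕ → Flow → Node → ℕ
  | 0 => fun _ _ => 0
  | t + 1 => nextBacklog net (arr t) (mu t) (backlog net arr mu t)

/-- `z` is admissible: for some packet arrival process with rate vector `z`, some scheduling
algorithm (a possibly random sequence of allowed activations) keeps every node backlog stable,
i.e. `limsup (1/t) ∑_{τ<t} E U_n^c(τ) < ∞`. -/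
def IsAdmissible (net : Network Node Flow) (z : Flow → ℝ) : Prop :=
  ∃ (Ω : Type) (_ : MeasurableSpace Ω) (P : Measure Ω) (_ : IsProbabilityMeasure P)
    (arr : ℕ → Ω → Flow → ℕ) (mu : ℕ → Ω → Flow → Node → Node → ℕ),
    (∀ t, Measurable (arr t)) ∧ (∀ t, Measurable (mu t)) ∧
    (∀ t c, Integrable (fun ω => (arr t ω c : ℝ)) P) ∧
    (∀ c, Tendsto (timeAvg fun t => ∫ ω, (arr t ω c : ℝ) ∂P) atTop (nhds (z c))) ∧
    (∀ t ω, IsActivation net (mu t ω)) ∧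
    (∀ c n, IsBoundedUnder (· ≤ ·) atTop
      (timeAvg fun t =>
        ∫ ω, (backlog net (fun s => arr s ω) (fun s => mu s ω) t c n : ℝ) ∂P))

/-- The capacity region `Λ`. -/
def capacityRegion (net : Network Node Flow) : Set (Flow → ℝ) := {z | IsAdmissible net z}

/-- `r` solves: maximize `∑ r_c` subject to `(r_c + ε) ∈ Λ` and `r_c ≥ a_c` for all `c`. -/
def IsOptimalRate (net : Network Node Flow) (a : Flow → ℝ) (ε : ℝ) (r : Flow → ℝ) : Prop :=
  r ∈ {x : Flow → ℝ | (fun c => x c + ε) ∈ capacityRegion net ∧ ∀ c, a c ≤ x c} ∧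
  IsMaxOn (fun x : Flow → ℝ => ∑ c, x c)
    {x : Flow → ℝ | (fun c => x c + ε) ∈ capacityRegion net ∧ ∀ c, a c ≤ x c} r

/-! ### Scheduling policy -/

/-- Weight `w_{mn}^c = (U_{s(c)}^c / q_M) (U_m^c - U_n^c)` of a link `(m, n)`. -/
def flowWeight (qM : ℝ) (Us : Flow → ℝ) (U : Flow → Node → ℕ) (c : Flow) (m n : Node) : ℝ :=
  Us c / qM * ((U c m : ℝ) - (U c n : ℝ))

/-- Weight of the virtual link `(s(c), b(c))`. -/
def admitWeight (net : Network Node Flow) (qM μM : ℝ) (Us : Flow → ℝ) (U : Flow → Node → ℕ)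
    (c : Flow) : ℝ :=
  Us c / qM * (qM - μM - (U c (net.src c) : ℝ))

/-- `c` is a candidate `c*_{mn}`: a flow of maximal weight on `(m, n)` among the flows allowed on
that link (a flow may not be looped back to its source). -/
def IsCandidate (net : Network Node Flow) (qM : ℝ) (Us : Flow → ℝ) (U : Flow → Node → ℕ)
    (m n : Node) (c : Flow) : Prop :=
  net.src c ≠ n ∧
    ∀ c', net.src c' ≠ n → flowWeight qM Us U c' m n ≤ flowWeight qM Us U c m n

/-- `w_{mn} = [max_c w_{mn}^c]^+`, over the flows allowed on `(m, n)`. -/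
def linkWeight (net : Network Node Flow) (qM : ℝ) (Us : Flow → ℝ) (U : Flow → Node → ℕ)
    (m n : Node) : ℝ :=
  (Finset.univ.filter fun c => net.src c ≠ n).fold max 0 fun c => flowWeight qM Us U c m n

/-- Constraints of the scheduling problem in one slot: an allowed activation that uses only
candidate flows, and numbers `adm c` of admitted packets with `adm c ≤ cap c`. -/
structure IsFeasible (net : Network Node Flow) (qM : ℝ) (Us : Flow → ℝ) (U : Flow → Node → ℕ)
    (cap : Flow → ℝ) (mu : Flow → Node → Node → ℕ) (adm : Flow → ℕ) : Prop where
  activation : IsActivation net mu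
  candidate : ∀ c m n, mu c m n ≠ 0 → IsCandidate net qM Us U m n c
  admitted : ∀ c, (adm c : ℝ) ≤ cap c

/-- The objective `∑ μ_{mn}^{c*_{mn}} w_{mn}` over all links and virtual links. -/
def objective (net : Network Node Flow) (qM μM : ℝ) (Us : Flow → ℝ) (U : Flow → Node → ℕ)
    (mu : Flow → Node → Node → ℕ) (adm : Flow → ℕ) : ℝ :=
  ∑ m, ∑ n, ((∑ c, mu c m n : ℕ) : ℝ) * linkWeight net qM Us U m n
    + ∑ c, (adm c : ℝ) * max (admitWeight net qM μM Us U c) 0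

/-- `(mu, adm)` is a decision of the scheduling policy: it is feasible, solves the maximum weight
problem, and is idle on (virtual) links of weight zero. -/
structure IsMaxWeight (net : Network Node Flow) (qM μM : ℝ) (Us : Flow → ℝ) (U : Flow → Node → ℕ)
    (cap : Flow → ℝ) (mu : Flow → Node → Node → ℕ) (adm : Flow → ℕ) : Prop where
  feasible : IsFeasible net qM Us U cap mu adm
  maximal : ∀ mu' adm', IsFeasible net qM Us U cap mu' adm' →
    objective net qM μM Us U mu' adm' ≤ objective net qM μM Us U mu adm
  idle_link : ∀ m n, linkWeight net qM Us U m n = 0 → ∀ c, mu c m n = 0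
  idle_admit : ∀ c, max (admitWeight net qM μM Us U c) 0 = 0 → adm c = 0

/-! ### The controlled network -/

/-- All random processes of the controlled network; the first argument is the time slot. -/
structure Processes (Node Flow Ω : Type*) where
  /-- packet arrivals `A_c(t)` at the transport layer -/
  A : ℕ → Ω → Flow → ℕ
  /-- transport-layer backlogs `L_c(t)` -/
  L : ℕ → Ω → Flow → ℝ
  /-- node backlogs `U_n^c(t)`, in packets -/
  U : ℕ → Ω → Flow → Node → ℕ
  /-- virtual queues `U_{s(c)}^c(t)` -/
  Us : ℕ → Ω → Flow → ℝ
  /-- virtual delay queues `X_c(t)` -/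
  X : ℕ → Ω → Flow → ℝ
  /-- virtual service queues `Z_c(t)` -/
  Z : ℕ → Ω → Flow → ℝ
  /-- auxiliary virtual queues `Y_c(t)` -/
  Y : ℕ → Ω → Flow → ℝ
  /-- link rate assignments `μ_{mn}^c(t)` -/
  mu : ℕ → Ω → Flow → Node → Node → ℕ
  /-- admitted packets `μ_{s(c)b(c)}^c(t)` -/
  adm : ℕ → Ω → Flow → ℕ
  /-- virtual input rates `R_c(t)` -/
  R : ℕ → Ω → Flow → ℝ
  /-- auxiliary variables `v_c(t)` -/
  v : ℕ → Ω → Flow → ℝ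

variable {Ω : Type*} [mΩ : MeasurableSpace Ω]

/-- The cap `min {L_c(t) + A_c(t), μ_M}`. -/
def Processes.cap (p : Processes Node Flow Ω) (μM : ℝ) (t : ℕ) (ω : Ω) (c : Flow) : ℝ :=
  min (p.L t ω c + (p.A t ω c : ℝ)) μM

/-- Arrivals: i.i.d. over time slots (as vectors over the flows), bounded by `μ_M`, with means
`lam c`; and no information available before the arrivals of slot `t` (the past `ℱ t`) depends on
them. Backlogs at `t` belong to the past at `t`, decisions of slot `t` to the past at `t + 1`. -/
structure Processes.IsCausal (p : Processes Node Flow Ω) (P : Measure Ω) (ℱ : Filtration ℕ mΩ)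
    (μM : ℝ) (lam : Flow → ℝ) : Prop where
  arrivals_bounded : ∀ t ω c, (p.A t ω c : ℝ) ≤ μM
  arrivals_indep : iIndepFun p.A P
  arrivals_ident : ∀ t, IdentDistrib (p.A t) (p.A 0) P P
  arrivals_mean : ∀ t c, ∫ ω, (p.A t ω c : ℝ) ∂P = lam c
  arrivals_indep_past : ∀ t, Indep (MeasurableSpace.comap (p.A t) inferInstance) (ℱ t) P
  meas_A : ∀ t, Measurable[ℱ (t + 1)] (p.A t)
  meas_L : Measurable[ℱ 0] (p.L 0)
  meas_U : ∀ t, Measurable[ℱ t] (p.U t)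
  meas_mu : ∀ t, Measurable[ℱ (t + 1)] (p.mu t)
  meas_adm : ∀ t, Measurable[ℱ (t + 1)] (p.adm t)
  meas_R : ∀ t, Measurable[ℱ (t + 1)] (p.R t)
  meas_v : ∀ t, Measurable[ℱ (t + 1)] (p.v t)

/-- Queue dynamics.  The update of the node backlogs is an inequality because fewer packets than
scheduled may arrive from a neighbour; subtraction of natural numbers is truncated at zero. -/
structure Processes.IsDynamics (p : Processes Node Flow Ω) (net : Network Node Flow) (LM : ℝ)
    (a ρ : Flow → ℝ) : Prop where
  U_zero : ∀ ω c n, p.U 0 ω c n = 0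
  U_dst : ∀ t ω c, p.U t ω c (net.dst c) = 0
  U_succ : ∀ t ω c n, n ≠ net.dst c → p.U (t + 1) ω c n ≤
    (p.U t ω c n - ∑ i, p.mu t ω c n i) + ∑ j, p.mu t ω c j n
      + (if n = net.src c then p.adm t ω c else 0)
  L_zero : ∀ ω c, 0 ≤ p.L 0 ω c ∧ p.L 0 ω c ≤ LM
  L_succ : ∀ t ω c, p.L (t + 1) ω c =
    min (max (p.L t ω c + (p.A t ω c : ℝ) - (p.adm t ω c : ℝ)) 0) LM
  Us_zero : ∀ ω c, p.Us 0 ω c = 0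
  Us_succ : ∀ t ω c, p.Us (t + 1) ω c = max (p.Us t ω c - (p.adm t ω c : ℝ)) 0 + p.R t ω c
  X_zero : ∀ ω c, p.X 0 ω c = 0
  X_succ : ∀ t ω c, p.X (t + 1) ω c =
    max (p.X t ω c - ρ c * p.R t ω c) 0 + ∑ n, (p.U t ω c n : ℝ)
  Z_zero : ∀ ω c, p.Z 0 ω c = 0
  Z_succ : ∀ t ω c, p.Z (t + 1) ω c = max (p.Z t ω c - p.R t ω c) 0 + a c
  Y_zero : ∀ ω c, p.Y 0 ω c = 0
  Y_succ : ∀ t ω c, p.Y (t + 1) ω c = max (p.Y t ω c - p.R t ω c) 0 + p.v t ω c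

/-- Decisions: in each slot `v_c` and `R_c` solve the two minimization problems of the congestion
controller (ties broken arbitrarily), and `(mu, adm)` is given by the scheduling policy. -/
structure Processes.IsControlled (p : Processes Node Flow Ω) (net : Network Node Flow)
    (qM μM η V : ℝ) (ρ : Flow → ℝ) : Prop where
  v_mem : ∀ t ω c, p.v t ω c ∈ Set.Icc 0 μM
  v_min : ∀ t ω c, IsMinOn (fun x : ℝ => x * (η * p.Y t ω c - V)) (Set.Icc 0 μM) (p.v t ω c)
  R_mem : ∀ t ω c, p.R t ω c ∈ Set.Icc 0 (p.cap μM t ω c)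
  R_min : ∀ t ω c, IsMinOn
    (fun x : ℝ => x * ((qM - μM) / qM * p.Us t ω c - η * p.Y t ω c - p.X t ω c * ρ c - p.Z t ω c))
    (Set.Icc 0 (p.cap μM t ω c)) (p.R t ω c)
  schedule : ∀ t ω, IsMaxWeight net qM μM (p.Us t ω) (p.U t ω) (p.cap μM t ω)
    (p.mu t ω) (p.adm t ω)

end

/-! ### Constants -/

/-- The constant `B`, with `N` nodes and `K` flows. -/
def constB (Node : Type*) {Flow : Type*} [Fintype Node] [Fintype Flow] (qM μM : ℝ)
    (a ρ : Flow → ℝ) : ℝ :=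
  let N : ℝ := Fintype.card Node
  let K : ℝ := Fintype.card Flow
  1 / 2 * N * K * qM * μM + K * ((qM - μM) / qM) * μM ^ 2 + 1 / 2 * μM ^ 2 * ∑ c, ρ c ^ 2
    + 1 / 2 * K * N ^ 2 * qM ^ 2 + 1 / 2 * K * μM ^ 2 + 1 / 2 * K * ∑ c, a c ^ 2

/-- `B₁ = B + K η μ_M²`. -/
def constB₁ (Node : Type*) {Flow : Type*} [Fintype Node] [Fintype Flow] (qM μM η : ℝ)
    (a ρ : Flow → ℝ) : ℝ :=
  constB Node qM μM a ρ + (Fintype.card Flow : ℝ) * η * μM ^ 2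

/-- `B₂ = B + K η μ_M² + V B_R`. -/
def constB₂ (Node : Type*) {Flow : Type*} [Fintype Node] [Fintype Flow] (qM μM η V BR : ℝ)
    (a ρ : Flow → ℝ) : ℝ :=
  constB Node qM μM a ρ + (Fintype.card Flow : ℝ) * η * μM ^ 2 + V * BR

end MultiHop

end

/-! The proof is a drift-plus-penalty argument. The Lyapunov function of a flow (`flowLyapunov`)
adds to weighted squares of the virtual queues the product of `Us / qM` with the squared node
backlogs. Because of this product, the drift bound contains exactly minus the objective of the
scheduling problem, and the coefficients of `R` and, once `V * v` is subtracted, of `v` are those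
which the congestion controller minimizes. Every decision therefore optimizes its own part of the
bound and may be compared with any other choice (`drift_plus_penalty_le`).

The comparison admits all arrivals `A`, takes the input rates `A * r / lam` and a constant auxiliary
rate `u`, and serves the rates `r + ε`. No stationary policy serving these rates has to be
constructed: weak duality (`sum_mul_rate_le_of_mem_capacityRegion`) says that admissible rates,
valued at node prices, are worth at most the best revenue of a single activation; otherwise the
priced backlog of a stabilizing policy would grow linearly. Max-weight scheduling is measured
against this revenue at the prices `Us * U / qM`. Arrivals are independent of the past, so they
average to `lam > r + ε`, and the surplus gives negative drift (`pastDrift_add_le`).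

The product term is harmless because the node backlogs never exceed `qM` (`U_le`). The choice `u =
0` bounds the queues, the reward `V * v` being controlled by `R` since `Y` is bounded; the choice `u
= r` bounds the throughput. Limits are taken in `EReal`, where `limsup` and `liminf` need no
boundedness proviso. -/

set_option linter.unusedSectionVars false

noncomputable section

namespace MultiHop

/-! ### Weak duality for the capacity region -/

section Capacity

variable {Node Flow : Type*} [Fintype Node]

/-- Summation by parts on the edges of a finite graph. -/
lemma sum_mul_sub_eq_sum_mul_netFlow (s : Node → Node → ℝ) (h : Node → ℝ) :
    ∑ m, ∑ n, s m n * (h m - h n) = ∑ n, h n * (∑ i, s n i - ∑ j, s j n) := by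
  have h1 : ∑ m, ∑ n, s m n * h n = ∑ n, ∑ m, s m n * h n := Finset.sum_comm
  simp only [mul_sub, Finset.sum_sub_distrib, h1, Finset.mul_sum]
  congr 1 <;> refine Finset.sum_congr rfl fun _ _ => Finset.sum_congr rfl fun _ _ => mul_comm _ _

/-- Subadditivity of truncation: what a node really loses is at most what its outgoing links, taken
separately, carry away. -/
lemma min_sum_le_sum_min {ι : Type*} (s : Finset ι) (f : ι → ℕ) (u : ℕ) :
    min (∑ i ∈ s, f i) u ≤ ∑ i ∈ s, min (f i) u := by
  classical
  induction s using Finset.induction_on with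
  | empty => simp
  | insert a s ha ih => rw [Finset.sum_insert ha, Finset.sum_insert ha]; omega

/-- The term `min mu U` of a link is the same at both of its ends, so that after weighting by prices
the terms can be summed by parts. The destination is excluded because packets vanish there. -/
lemma nextBacklog_ge [DecidableEq Node] (net : Network Node Flow) (arr : Flow → ℕ)
    (mu : Flow → Node → Node → ℕ) (U : Flow → Node → ℕ) (c : Flow) (n : Node) (hn : n ≠ net.dst c) :
    (U c n : ℝ) - ∑ i, ((min (mu c n i) (U c n) : ℕ) : ℝ)
      + ∑ j, ((min (mu c j n) (U c j) : ℕ) : ℝ)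
      + (if n = net.src c then (arr c : ℝ) else 0) ≤ nextBacklog net arr mu U c n := by
  have h := min_sum_le_sum_min Finset.univ (fun i => mu c n i) (U c n)
  have h2 : U c n ≤ (U c n - ∑ i, mu c n i) + ∑ i, min (mu c n i) (U c n) := by omega
  have h3 : (U c n : ℝ) ≤ ((U c n - ∑ i, mu c n i : ℕ) : ℝ)
      + ∑ i, ((min (mu c n i) (U c n) : ℕ) : ℝ) := by exact_mod_cast h2
  rw [nextBacklog, if_neg hn]
  rw [Nat.cast_add, Nat.cast_add, Nat.cast_sum, Nat.cast_ite, Nat.cast_zero]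
  linarith

section Integrability

variable [DecidableEq Node] {Ω : Type*} [MeasurableSpace Ω] {P : Measure Ω}
  {arr : ℕ → Ω → Flow → ℕ}
  {mu : ℕ → Ω → Flow → Node → Node → ℕ}

lemma measurable_backlog (net : Network Node Flow) (harr : ∀ t, Measurable (arr t))
    (hmu : ∀ t, Measurable (mu t)) (t : ℕ) (c : Flow) (n : Node) :
    Measurable fun ω => backlog net (fun s => arr s ω) (fun s => mu s ω) t c n := by
  induction t generalizing c n with
  | zero => exact measurable_const
  | succ t ih =>
    have hm : ∀ c m n, Measurable fun ω => mu t ω c m n := fun c m n => by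
      have := hmu t; fun_prop
    have ha : ∀ c, Measurable fun ω => arr t ω c := fun c => by
      have := harr t; fun_prop
    simp only [backlog, nextBacklog]
    split_ifs
    · exact measurable_const
    all_goals
      refine Measurable.fun_add (Measurable.fun_add (Measurable.fun_sub (ih c n) ?_) ?_) ?_
      · exact Finset.measurable_sum _ fun i _ => hm c n i
      · exact Finset.measurable_sum _ fun j _ => (hm c j n).min (ih c j)
      · first | exact ha c | exact measurable_const

lemma integrable_backlog (net : Network Node Flow) (harr : ∀ t, Measurable (arr t))
    (hmu : ∀ t, Measurable (mu t)) (hint : ∀ t c, Integrable (fun ω => (arr t ω c : ℝ)) P)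
    (t : ℕ) (c : Flow) (n : Node) :
    Integrable (fun ω => (backlog net (fun s => arr s ω) (fun s => mu s ω) t c n : ℝ)) P := by
  induction t generalizing c n with
  | zero => simp [backlog]
  | succ t ih =>
    have hg : Integrable (fun ω =>
        (backlog net (fun s => arr s ω) (fun s => mu s ω) t c n : ℝ)
        + ∑ j, (backlog net (fun s => arr s ω) (fun s => mu s ω) t c j : ℝ)
        + (arr t ω c : ℝ)) P :=
      ((ih c n).add (integrable_finsetSum _ fun j _ => ih c j)).add (hint t c)
    refine hg.mono' (measurable_from_nat.comp
      (measurable_backlog net harr hmu (t + 1) c n)).aestronglyMeasurable (.of_forall fun ω => ?_)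
    rw [Real.norm_of_nonneg (Nat.cast_nonneg _)]
    have : backlog net (fun s => arr s ω) (fun s => mu s ω) (t + 1) c n ≤
        backlog net (fun s => arr s ω) (fun s => mu s ω) t c n
        + ∑ j, backlog net (fun s => arr s ω) (fun s => mu s ω) t c j + arr t ω c := by
      rw [backlog, nextBacklog]
      split_ifs
      · exact Nat.zero_le _
      all_goals
        refine add_le_add (add_le_add (Nat.sub_le _ _)
          (Finset.sum_le_sum fun j _ => min_le_right _ _)) ?_
        simp
    exact_mod_cast this

end Integrability

variable [Fintype Flow]

/-- Applied to the packets really sent, which thereby form an activation themselves. -/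
lemma IsActivation.mono {net : Network Node Flow} {mu s : Flow → Node → Node → ℕ}
    (hmu : IsActivation net mu) (hs : ∀ c m n, s c m n ≤ mu c m n) : IsActivation net s where
  off_link c m n h := Nat.le_zero.1 (hmu.off_link c m n h ▸ hs c m n)
  le_one c m n := (hs c m n).trans (hmu.le_one c m n)
  no_loop c := Nat.le_zero.1 <|
    (Finset.sum_le_sum fun m _ => hs c m (net.src c)).trans (hmu.no_loop c).le
  exclusive n := le_trans (Finset.sum_le_sum fun c _ => add_le_add
    (Finset.sum_le_sum fun i _ => hs c n i) (Finset.sum_le_sum fun j _ => hs c j n))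
    (hmu.exclusive n)

variable [DecidableEq Node]

/-- Drift of a linear functional of the backlogs of the uncontrolled network. -/
lemma weighted_nextBacklog_ge (net : Network Node Flow) {arr : Flow → ℕ}
    {mu : Flow → Node → Node → ℕ} {U : Flow → Node → ℕ} {h : Flow → Node → ℝ} {M : ℝ}
    (hmu : IsActivation net mu) (h0 : ∀ c n, 0 ≤ h c n) (hd : ∀ c, h c (net.dst c) = 0)
    (hM : ∀ s, IsActivation net s → ∑ c, ∑ m, ∑ n, (s c m n : ℝ) * (h c m - h c n) ≤ M) :
    ∑ c, ∑ n, h c n * (U c n : ℝ) - M + ∑ c, h c (net.src c) * (arr c : ℝ) ≤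
      ∑ c, ∑ n, h c n * (nextBacklog net arr mu U c n : ℝ) := by
  have hs := hM (fun c m n => min (mu c m n) (U c m)) (hmu.mono fun _ _ _ => min_le_left _ _)
  simp only [sum_mul_sub_eq_sum_mul_netFlow] at hs
  have key : ∑ c, (∑ n, h c n * (U c n : ℝ)
      - ∑ n, h c n * (∑ i, ((min (mu c n i) (U c n) : ℕ) : ℝ)
        - ∑ j, ((min (mu c j n) (U c j) : ℕ) : ℝ)) + h c (net.src c) * (arr c : ℝ)) ≤
      ∑ c, ∑ n, h c n * (nextBacklog net arr mu U c n : ℝ) := by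
    refine Finset.sum_le_sum fun c _ => ?_
    have hsrc : h c (net.src c) * (arr c : ℝ)
        = ∑ n, h c n * (if n = net.src c then (arr c : ℝ) else 0) := by simp
    rw [hsrc, ← Finset.sum_sub_distrib, ← Finset.sum_add_distrib]
    refine Finset.sum_le_sum fun n _ => ?_
    -- Packets disappear at the destination, but its price is zero.
    by_cases hn : n = net.dst c
    · simp [hn, hd]
    · have := mul_le_mul_of_nonneg_left (nextBacklog_ge net arr mu U c n hn) (h0 c n)
      linarith
  rw [Finset.sum_add_distrib, Finset.sum_sub_distrib] at key
  linarith

lemma timeAvg_sum_mul {ι : Type*} (s : Finset ι) (w : ι → ℝ) (f : ι → ℕ → ℝ) (t : ℕ) :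
    timeAvg (fun τ => ∑ i ∈ s, w i * f i τ) t = ∑ i ∈ s, w i * timeAvg (f i) t := by
  simp only [timeAvg, Finset.mul_sum]
  rw [Finset.sum_comm]
  exact Finset.sum_congr rfl fun _ _ => Finset.sum_congr rfl fun _ _ => by ring

/-- A nonnegative sequence that is eventually above every constant has unbounded time averages. -/
lemma not_eventually_timeAvg_le {f : ℕ → ℝ} (h0 : ∀ t, 0 ≤ f t) (hf : Tendsto f atTop atTop)
    (C : ℝ) : ¬ ∀ᶠ t in atTop, timeAvg f t ≤ C := by
  intro hC
  obtain ⟨T₀, hT₀⟩ := eventually_atTop.1 (hf.eventually_ge_atTop (|C| + 1))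
  -- The slots after `T₀` contribute at least `(T - T₀) * (|C| + 1)`, which exceeds `T * |C|` as
  -- soon as `T > T₀ * (|C| + 1)`.
  obtain ⟨T, hT, hT1, hT2⟩ := (hC.and ((eventually_ge_atTop (T₀ + 1)).and
    (tendsto_natCast_atTop_atTop.eventually_gt_atTop (T₀ * (|C| + 1))))).exists
  have hTpos : (0 : ℝ) < T := by exact_mod_cast (by omega : 0 < T)
  have h1 : ∑ τ ∈ Finset.Ico T₀ T, (|C| + 1) ≤ ∑ τ ∈ Finset.range T, f τ :=
    (Finset.sum_le_sum fun τ hτ => hT₀ τ (Finset.mem_Ico.1 hτ).1).trans <|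
      Finset.sum_le_sum_of_subset_of_nonneg
        (fun τ hτ => Finset.mem_range.2 (Finset.mem_Ico.1 hτ).2) fun τ _ _ => h0 τ
  rw [Finset.sum_const, Nat.card_Ico, nsmul_eq_mul, Nat.cast_sub (by omega)] at h1
  rw [timeAvg, one_div, inv_mul_le_iff₀ hTpos] at hT
  nlinarith [le_abs_self C]

/-- Weak duality for the capacity region: an admissible rate vector, weighted by node prices that
vanish at the destinations, costs no more than the best activation earns. -/
theorem sum_mul_rate_le_of_mem_capacityRegion (net : Network Node Flow) {z : Flow → ℝ}
    (hz : z ∈ capacityRegion net) {h : Flow → Node → ℝ} {M : ℝ}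
    (h0 : ∀ c n, 0 ≤ h c n) (hd : ∀ c, h c (net.dst c) = 0)
    (hM : ∀ s, IsActivation net s → ∑ c, ∑ m, ∑ n, (s c m n : ℝ) * (h c m - h c n) ≤ M) :
    ∑ c, h c (net.src c) * z c ≤ M := by
  obtain ⟨Ω, _, P, _, arr, mu, harr, hmu, hint, hrate, hact, hstab⟩ := hz
  set E : ℕ → Flow → Node → ℝ := fun t c n =>
    ∫ ω, (backlog net (fun s => arr s ω) (fun s => mu s ω) t c n : ℝ) ∂P with hE
  have hEint := integrable_backlog (P := P) net harr hmu hint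
  set F : ℕ → ℝ := fun t => ∑ c, ∑ n, h c n * E t c n with hF
  have hstep : ∀ t, F t - M + ∑ c, h c (net.src c) * ∫ ω, (arr t ω c : ℝ) ∂P ≤ F (t + 1) := by
    intro t
    have hI : ∀ t, F t = ∫ ω, ∑ c, ∑ n, h c n *
        (backlog net (fun s => arr s ω) (fun s => mu s ω) t c n : ℝ) ∂P := by
      intro t
      rw [integral_finsetSum _ fun c _ => integrable_finsetSum _ fun n _ =>
        (hEint t c n).const_mul _]
      refine Finset.sum_congr rfl fun c _ => ?_
      rw [integral_finsetSum _ fun n _ => (hEint t c n).const_mul _]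
      exact Finset.sum_congr rfl fun n _ => (integral_const_mul _ _).symm
    have hIi : ∀ t, Integrable (fun ω => ∑ c, ∑ n, h c n *
        (backlog net (fun s => arr s ω) (fun s => mu s ω) t c n : ℝ)) P := fun t =>
      integrable_finsetSum _ fun c _ => integrable_finsetSum _ fun n _ => (hEint t c n).const_mul _
    have hAi : Integrable (fun ω => ∑ c, h c (net.src c) * (arr t ω c : ℝ)) P :=
      integrable_finsetSum _ fun c _ => (hint t c).const_mul _
    have hA : ∑ c, h c (net.src c) * ∫ ω, (arr t ω c : ℝ) ∂P =
        ∫ ω, ∑ c, h c (net.src c) * (arr t ω c : ℝ) ∂P := by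
      rw [integral_finsetSum _ fun c _ => (hint t c).const_mul _]
      exact Finset.sum_congr rfl fun c _ => (integral_const_mul _ _).symm
    have hMc : M = ∫ _, M ∂P := by simp
    rw [hI, hI, hA]
    nth_rewrite 1 [hMc]
    have hIM : Integrable (fun ω => ∑ c, ∑ n, h c n *
        (backlog net (fun s => arr s ω) (fun s => mu s ω) t c n : ℝ) - M) P :=
      (hIi t).sub (integrable_const (μ := P) M)
    rw [← integral_sub (hIi t) (integrable_const M), ← integral_add hIM hAi]
    exact integral_mono (hIM.add hAi) (hIi (t + 1)) fun ω =>
      weighted_nextBacklog_ge net (hact t ω) h0 hd hM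
  have hF0 : F 0 = 0 := by simp [hF, hE, backlog]
  have hsum : ∀ T, ∑ t ∈ Finset.range T, ∑ c, h c (net.src c) * ∫ ω, (arr t ω c : ℝ) ∂P - T * M
      ≤ F T := by
    intro T
    induction T with
    | zero => simp [hF0]
    | succ T ih =>
      rw [Finset.sum_range_succ]
      have := hstep T
      push_cast
      linarith
  -- If the priced rate `S` exceeded `M`, `hsum` would make `F` grow eventually at least with slope
  -- `(S - M) / 2`, whereas stability bounds its time averages.
  by_contra! hlt
  have hFnn : ∀ t, 0 ≤ F t := fun t => Finset.sum_nonneg fun c _ => Finset.sum_nonneg fun n _ =>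
    mul_nonneg (h0 c n) (integral_nonneg fun ω => Nat.cast_nonneg _)
  choose b hb using hstab
  simp only [eventually_map] at hb
  refine not_eventually_timeAvg_le hFnn ?_ (∑ c, ∑ n, h c n * b c n) ?_
  · have hlim : Tendsto (timeAvg fun t => ∑ c, h c (net.src c) * ∫ ω, (arr t ω c : ℝ) ∂P) atTop
        (nhds (∑ c, h c (net.src c) * z c)) := by
      refine Tendsto.congr (fun t => (timeAvg_sum_mul _ _ _ t).symm) ?_
      exact tendsto_finsetSum _ fun c _ => (hrate c).const_mul _
    set S := ∑ c, h c (net.src c) * z c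
    have hev := hlim.eventually (lt_mem_nhds (by linarith : (S + M) / 2 < S))
    have hlin : Tendsto (fun t : ℕ => (S - M) / 2 * (t : ℝ)) atTop atTop :=
      tendsto_natCast_atTop_atTop.const_mul_atTop (by linarith)
    refine tendsto_atTop_mono' _ ?_ hlin
    filter_upwards [hev, eventually_gt_atTop 0] with T hT hT0
    have hT0' : (0 : ℝ) < T := by exact_mod_cast hT0
    rw [timeAvg, one_div, ← div_eq_inv_mul, lt_div_iff₀ hT0'] at hT
    have := hsum T
    linarith
  · have hall : ∀ᶠ t in atTop, ∀ c n, timeAvg (fun t => E t c n) t ≤ b c n :=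
      eventually_all.2 fun c => eventually_all.2 fun n => hb c n
    filter_upwards [hall] with T hT
    have h1 : timeAvg F T = ∑ c, ∑ n, h c n * timeAvg (fun t => E t c n) T := by
      have h2 := timeAvg_sum_mul Finset.univ (fun _ : Flow => (1 : ℝ))
        (fun c t => ∑ n, h c n * E t c n) T
      simp only [one_mul] at h2
      rw [hF, h2]
      exact Finset.sum_congr rfl fun c _ => timeAvg_sum_mul _ _ _ _
    rw [h1]
    exact Finset.sum_le_sum fun c _ => Finset.sum_le_sum fun n _ =>
      mul_le_mul_of_nonneg_left (hT c n) (h0 c n)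

end Capacity

/-! ### The max-weight scheduling policy in one slot -/

section Policy

variable {Node Flow : Type*} [Fintype Node] [DecidableEq Node] [Fintype Flow]
  {net : Network Node Flow} {qM μM : ℝ} {Us : Flow → ℝ} {U : Flow → Node → ℕ} {cap : Flow → ℝ}
  {mu : Flow → Node → Node → ℕ} {adm : Flow → ℕ}

lemma linkWeight_nonneg (net : Network Node Flow) (qM : ℝ) (Us : Flow → ℝ) (U : Flow → Node → ℕ)
    (m n : Node) : 0 ≤ linkWeight net qM Us U m n :=
  Finset.le_fold_max _ |>.2 (.inl le_rfl)

lemma flowWeight_le_linkWeight {c : Flow} {m n : Node} (hc : net.src c ≠ n) :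
    flowWeight qM Us U c m n ≤ linkWeight net qM Us U m n :=
  Finset.le_fold_max _ |>.2 (.inr ⟨c, by simpa using hc, le_rfl⟩)

lemma IsCandidate.linkWeight_eq {c : Flow} {m n : Node} (hc : IsCandidate net qM Us U m n c) :
    linkWeight net qM Us U m n = max 0 (flowWeight qM Us U c m n) := by
  refine le_antisymm (Finset.fold_max_le _ |>.2 ⟨le_max_left _ _, fun c' hc' => ?_⟩)
    (max_le (linkWeight_nonneg ..) (flowWeight_le_linkWeight hc.1))
  exact (hc.2 c' (by simpa using hc')).trans (le_max_right _ _)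

lemma exists_isCandidate {c : Flow} {m n : Node} (hc : net.src c ≠ n) :
    ∃ c', IsCandidate net qM Us U m n c' := by
  obtain ⟨c', hc', hmax⟩ := (Finset.univ.filter fun c => net.src c ≠ n).exists_max_image
    (fun c => flowWeight qM Us U c m n) ⟨c, by simpa using hc⟩
  exact ⟨c', by simpa using hc', fun c'' hc'' => hmax c'' (by simpa using hc'')⟩

lemma IsActivation.src_ne (hmu : IsActivation net mu) {c : Flow} {m n : Node}
    (h : mu c m n ≠ 0) : net.src c ≠ n := by
  rintro rfl
  exact h (Finset.sum_eq_zero_iff.1 (hmu.no_loop c) m (Finset.mem_univ _))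

lemma IsActivation.sum_swap (mu : Flow → Node → Node → ℕ) (n : Node) :
    ∑ c, (∑ i, mu c n i + ∑ j, mu c j n) = ∑ i, ∑ c, mu c n i + ∑ j, ∑ c, mu c j n := by
  rw [Finset.sum_add_distrib, Finset.sum_comm, Finset.sum_comm (f := fun c j => mu c j n)]

lemma IsActivation.sum_flow_le_one (hmu : IsActivation net mu) (m n : Node) :
    ∑ c, mu c m n ≤ 1 :=
  (Finset.sum_le_sum fun c _ => (Finset.single_le_sum (f := fun i => mu c m i)
    (fun _ _ => Nat.zero_le _) (Finset.mem_univ n)).trans (Nat.le_add_right _ _)).trans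
    (hmu.exclusive m)

/-- Every activation can be rerouted onto candidate flows without changing the link usage. -/
lemma IsActivation.exists_candidate (hmu : IsActivation net mu) (qM : ℝ) (Us : Flow → ℝ)
    (U : Flow → Node → ℕ) :
    ∃ s : Flow → Node → Node → ℕ, IsActivation net s ∧
      (∀ c m n, s c m n ≠ 0 → IsCandidate net qM Us U m n c) ∧
      ∀ m n, ∑ c, s c m n = ∑ c, mu c m n := by
  classical
  have hex : ∀ m n, ∃ s : Flow → ℕ, (∀ c, s c ≠ 0 → IsCandidate net qM Us U m n c) ∧
      (∀ c, s c ≠ 0 → (m, n) ∈ net.links) ∧ ∑ c, s c = ∑ c, mu c m n := by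
    intro m n
    by_cases h : ∃ c, mu c m n ≠ 0
    · obtain ⟨c, hc⟩ := h
      obtain ⟨c', hc'⟩ := exists_isCandidate (qM := qM) (Us := Us) (U := U) (m := m)
        (hmu.src_ne hc)
      refine ⟨Pi.single c' (∑ c, mu c m n), fun c'' h => ?_, fun _ _ => ?_, by simp⟩
      · rwa [of_not_not (mt (fun hne : c'' ≠ c' => Pi.single_eq_of_ne hne _) h)]
      · by_contra hl
        exact hc (hmu.off_link c m n hl)
    · push Not at h
      exact ⟨0, by simp, by simp, by simp [h]⟩
  choose s hs hl hsum using hex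
  refine ⟨fun c m n => s m n c, ⟨fun c m n h => ?_, fun c m n => ?_, fun c => ?_, fun n => ?_⟩,
    fun c m n => hs m n c, hsum⟩
  · by_contra hne
    exact h (hl m n c hne)
  · exact ((Finset.single_le_sum (f := s m n) (fun _ _ => Nat.zero_le _)
      (Finset.mem_univ c)).trans (hsum m n).le).trans (hmu.sum_flow_le_one m n)
  · refine Finset.sum_eq_zero fun m _ => ?_
    by_contra hne
    exact (hs m _ c hne).1 rfl
  -- Interference depends on the total use of each link only, and rerouting preserves it.
  · rw [IsActivation.sum_swap (fun c m n => s m n c)]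
    simp only [hsum]
    rw [← IsActivation.sum_swap]
    exact hmu.exclusive n

lemma sum_flow_mul_comm (mu : Flow → Node → Node → ℕ) (w : Node → Node → ℝ) :
    ∑ m, ∑ n, ((∑ c, mu c m n : ℕ) : ℝ) * w m n = ∑ c, ∑ m, ∑ n, (mu c m n : ℝ) * w m n := by
  simp only [Nat.cast_sum, Finset.sum_mul]
  rw [Finset.sum_comm]
  simp only [Finset.sum_comm (s := (Finset.univ : Finset Flow))]
  rw [Finset.sum_comm]

/-- The scheduling policy does at least as well as any activation together with any admissible
numbers of admitted packets. -/
lemma IsMaxWeight.le_objective (h : IsMaxWeight net qM μM Us U cap mu adm)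
    {mu' : Flow → Node → Node → ℕ} {adm' : Flow → ℕ} (hmu' : IsActivation net mu')
    (hadm' : ∀ c, (adm' c : ℝ) ≤ cap c) :
    ∑ c, ∑ m, ∑ n, (mu' c m n : ℝ) * flowWeight qM Us U c m n
      + ∑ c, (adm' c : ℝ) * max (admitWeight net qM μM Us U c) 0
      ≤ objective net qM μM Us U mu adm := by
  obtain ⟨s, hs, hcand, hsum⟩ := hmu'.exists_candidate qM Us U
  refine le_trans ?_ (h.maximal s adm' ⟨hs, hcand, hadm'⟩)
  rw [objective]
  gcongr ?_ + _
  simp only [hsum]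
  rw [sum_flow_mul_comm]
  refine Finset.sum_le_sum fun c _ => Finset.sum_le_sum fun m _ => Finset.sum_le_sum fun n _ => ?_
  by_cases h0 : mu' c m n = 0
  · simp [h0]
  · exact mul_le_mul_of_nonneg_left (flowWeight_le_linkWeight (hmu'.src_ne h0))
      (Nat.cast_nonneg _)

/-- Since the policy idles on links of weight zero, the truncation in `linkWeight` is inactive on
every link in use. The strict sign also makes packets move downhill only, which keeps the backlogs
bounded. -/
lemma IsMaxWeight.flowWeight_pos (h : IsMaxWeight net qM μM Us U cap mu adm) {c : Flow}
    {m n : Node} (hc : mu c m n ≠ 0) :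
    0 < flowWeight qM Us U c m n ∧ linkWeight net qM Us U m n = flowWeight qM Us U c m n := by
  have h1 := (h.feasible.candidate c m n hc).linkWeight_eq
  have h2 : linkWeight net qM Us U m n ≠ 0 := fun h0 => hc (h.idle_link m n h0 c)
  rcases le_or_gt (flowWeight qM Us U c m n) 0 with h3 | h3
  · rw [max_eq_left h3] at h1
    exact absurd h1 h2
  · exact ⟨h3, by rw [h1, max_eq_right h3.le]⟩

lemma IsMaxWeight.admitWeight_pos (h : IsMaxWeight net qM μM Us U cap mu adm) {c : Flow}
    (hc : adm c ≠ 0) : 0 < admitWeight net qM μM Us U c := by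
  obtain ⟨-, -, -, hidle⟩ := h
  by_contra! h0
  exact hc (hidle c (max_eq_right h0))

/-- Without the truncations the objective is the expression that appears in the Lyapunov drift. -/
lemma IsMaxWeight.objective_eq (h : IsMaxWeight net qM μM Us U cap mu adm) :
    objective net qM μM Us U mu adm =
      ∑ c, ∑ m, ∑ n, (mu c m n : ℝ) * flowWeight qM Us U c m n
        + ∑ c, (adm c : ℝ) * admitWeight net qM μM Us U c := by
  rw [objective, sum_flow_mul_comm]
  congr 1
  · refine Finset.sum_congr rfl fun c _ => Finset.sum_congr rfl fun m _ =>
      Finset.sum_congr rfl fun n _ => ?_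
    by_cases h0 : mu c m n = 0
    · simp [h0]
    · rw [(h.flowWeight_pos h0).2]
  · refine Finset.sum_congr rfl fun c _ => ?_
    by_cases h0 : adm c = 0
    · simp [h0]
    · rw [max_eq_left (h.admitWeight_pos h0).le]

/-- Lower bound for the weight served by the policy, in terms of an admissible rate vector `z` and
of numbers `k` of packets that can be admitted. -/
lemma IsMaxWeight.capacity_le (h : IsMaxWeight net qM μM Us U cap mu adm) {z : Flow → ℝ}
    (hz : z ∈ capacityRegion net) (hqM : 0 < qM) (hUs : ∀ c, 0 ≤ Us c)
    (hU : ∀ c, U c (net.dst c) = 0) {k : Flow → ℕ} (hk : ∀ c, (k c : ℝ) ≤ cap c) :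
    ∑ c, Us c / qM * U c (net.src c) * z c
        + ∑ c, (k c : ℝ) * max (admitWeight net qM μM Us U c) 0 ≤
      ∑ c, ∑ m, ∑ n, (mu c m n : ℝ) * flowWeight qM Us U c m n
        + ∑ c, (adm c : ℝ) * admitWeight net qM μM Us U c := by
  rw [← h.objective_eq]
  rw [← le_sub_iff_add_le]
  -- With the prices `Us / qM * U`, the price drop along a link is its flow weight, so the best
  -- revenue is at most the objective less the admission part.
  refine sum_mul_rate_le_of_mem_capacityRegion net hz
    (h := fun c n => Us c / qM * U c n)
    (fun c n => mul_nonneg (div_nonneg (hUs c) hqM.le) (Nat.cast_nonneg _))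
    (fun c => by simp [hU]) fun s hs => ?_
  rw [le_sub_iff_add_le]
  simpa only [flowWeight, mul_sub] using h.le_objective hs hk

/-- A node that receives a packet over a link gets at most one packet, and from a node with a
larger backlog. -/
lemma IsMaxWeight.inflow_le (h : IsMaxWeight net qM μM Us U cap mu adm) (hqM : 0 < qM)
    (hUs : ∀ c, 0 ≤ Us c) (c : Flow) (n : Node) {b : ℝ} (hb : ∀ m, (U c m : ℝ) ≤ b) :
    (U c n : ℝ) + ∑ j, (mu c j n : ℝ) ≤ b := by
  by_cases h0 : ∀ j, mu c j n = 0
  · simpa [h0] using hb n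
  · push Not at h0
    obtain ⟨m, hm⟩ := h0
    have hpos := (h.flowWeight_pos hm).1
    rw [flowWeight] at hpos
    have hlt : (U c n : ℝ) < U c m :=
      sub_pos.1 (pos_of_mul_pos_right hpos (div_nonneg (hUs c) hqM.le))
    -- Backlogs are integers, so a strict drop leaves room for one packet.
    have hlt' : (U c n : ℝ) + 1 ≤ U c m := by exact_mod_cast hlt
    have hsum : ∑ j, mu c j n ≤ 1 :=
      ((Nat.le_add_left _ _).trans (Finset.single_le_sum
        (f := fun c => ∑ i, mu c n i + ∑ j, mu c j n)
        (fun _ _ => Nat.zero_le _) (Finset.mem_univ c))).trans (h.feasible.activation.exclusive n)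
    have hsum' : ∑ j, (mu c j n : ℝ) ≤ 1 := by exact_mod_cast hsum
    linarith [hb m]

/-- A positive admission weight means that the source backlog is below `qM - μM`, and at most `μM`
packets enter. -/
lemma IsMaxWeight.admit_le (h : IsMaxWeight net qM μM Us U cap mu adm) (hqM : 0 < qM)
    (hUs : ∀ c, 0 ≤ Us c) (hcap : ∀ c, cap c ≤ μM) (c : Flow)
    (hb : (U c (net.src c) : ℝ) ≤ qM) : (U c (net.src c) : ℝ) + adm c ≤ qM := by
  by_cases h0 : adm c = 0
  · simpa [h0] using hb
  · have hpos := h.admitWeight_pos h0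
    rw [admitWeight] at hpos
    have := pos_of_mul_pos_right hpos (div_nonneg (hUs c) hqM.le)
    linarith [h.feasible.admitted c, hcap c]

end Policy

/-! ### Closure properties of bounded measurable functions, for integrability and adaptedness
together -/

section BoundedMeasurable

variable {Ω : Type*} {m m' : MeasurableSpace Ω} {f g : Ω → ℝ}

/-- Bounded real functions that are measurable with respect to a given `σ`-algebra. -/
structure IsBddMeasurable (m : MeasurableSpace Ω) (f : Ω → ℝ) : Prop where
  measurable : Measurable[m] f
  bounded : ∃ C, ∀ ω, |f ω| ≤ C

namespace IsBddMeasurable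

lemma of_mem_Icc {a b : ℝ} (hf : Measurable[m] f) (h : ∀ ω, f ω ∈ Set.Icc a b) :
    IsBddMeasurable m f :=
  ⟨hf, max |a| |b|, fun ω => abs_le_max_abs_abs (h ω).1 (h ω).2⟩

lemma const (m : MeasurableSpace Ω) (C : ℝ) : IsBddMeasurable m fun _ => C :=
  ⟨measurable_const, |C|, fun _ => le_rfl⟩

lemma mono (hf : IsBddMeasurable m f) (h : m ≤ m') : IsBddMeasurable m' f :=
  ⟨hf.measurable.mono h le_rfl, hf.bounded⟩

lemma add (hf : IsBddMeasurable m f) (hg : IsBddMeasurable m g) :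
    IsBddMeasurable m fun ω => f ω + g ω := by
  obtain ⟨C, hC⟩ := hf.bounded
  obtain ⟨D, hD⟩ := hg.bounded
  exact ⟨hf.measurable.fun_add hg.measurable, C + D,
    fun ω => (abs_add_le _ _).trans (add_le_add (hC ω) (hD ω))⟩

lemma mul (hf : IsBddMeasurable m f) (hg : IsBddMeasurable m g) :
    IsBddMeasurable m fun ω => f ω * g ω := by
  obtain ⟨C, hC⟩ := hf.bounded
  obtain ⟨D, hD⟩ := hg.bounded
  refine ⟨hf.measurable.fun_mul hg.measurable, C * D, fun ω => ?_⟩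
  rw [abs_mul]
  exact mul_le_mul (hC ω) (hD ω) (abs_nonneg _) ((abs_nonneg _).trans (hC ω))

lemma const_mul (C : ℝ) (hf : IsBddMeasurable m f) : IsBddMeasurable m fun ω => C * f ω :=
  (const m C).mul hf

lemma sub (hf : IsBddMeasurable m f) (hg : IsBddMeasurable m g) :
    IsBddMeasurable m fun ω => f ω - g ω := by
  simpa [sub_eq_add_neg] using hf.add (hg.const_mul (-1))

lemma pow (hf : IsBddMeasurable m f) (k : ℕ) : IsBddMeasurable m fun ω => f ω ^ k := by
  induction k with
  | zero => simpa using const m 1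
  | succ k ih => simpa [pow_succ] using ih.mul hf

lemma max_zero (hf : IsBddMeasurable m f) : IsBddMeasurable m fun ω => max (f ω) 0 := by
  obtain ⟨C, hC⟩ := hf.bounded
  refine ⟨hf.measurable.max measurable_const, C, fun ω => ?_⟩
  rw [abs_of_nonneg (le_max_right _ _)]
  exact max_le ((le_abs_self _).trans (hC ω)) ((abs_nonneg _).trans (hC ω))

lemma sum {ι : Type*} (s : Finset ι) {f : ι → Ω → ℝ} (hf : ∀ i, IsBddMeasurable m (f i)) :
    IsBddMeasurable m fun ω => ∑ i ∈ s, f i ω := by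
  classical
  induction s using Finset.induction_on with
  | empty => simpa using const m 0
  | insert a s ha ih => simpa [Finset.sum_insert ha] using (hf a).add ih

lemma integrable {mΩ : MeasurableSpace Ω} {P : Measure Ω} [IsFiniteMeasure P]
    (hf : IsBddMeasurable m f) (hm : m ≤ mΩ) : Integrable f P := by
  obtain ⟨C, hC⟩ := hf.bounded
  exact .of_bound (hf.mono hm).measurable.aestronglyMeasurable C (.of_forall hC)

end IsBddMeasurable

end BoundedMeasurable

namespace Processes

variable {Node Flow : Type*} [Fintype Node] [DecidableEq Node] [Fintype Flow]
  {Ω : Type*} [mΩ : MeasurableSpace Ω] {P : Measure Ω} {ℱ : Filtration ℕ mΩ}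
  {p : Processes Node Flow Ω} {net : Network Node Flow} {qM μM η V LM : ℝ} {a ρ lam : Flow → ℝ}

/-! ### Deterministic bounds on the queues -/

section Bounds

lemma cap_le (p : Processes Node Flow Ω) (μM : ℝ) (t : ℕ) (ω : Ω) (c : Flow) :
    p.cap μM t ω c ≤ μM := min_le_right _ _

lemma IsControlled.R_le (hC : p.IsControlled net qM μM η V ρ) (t : ℕ) (ω : Ω) (c : Flow) :
    p.R t ω c ≤ μM := (hC.R_mem t ω c).2.trans (p.cap_le μM t ω c)

lemma IsControlled.adm_le (hC : p.IsControlled net qM μM η V ρ) (t : ℕ) (ω : Ω) (c : Flow) :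
    (p.adm t ω c : ℝ) ≤ μM :=
  ((hC.schedule t ω).feasible.admitted c).trans (p.cap_le μM t ω c)

lemma IsDynamics.L_nonneg (hD : p.IsDynamics net LM a ρ) (hLM : 0 ≤ LM) (t : ℕ) (ω : Ω)
    (c : Flow) : 0 ≤ p.L t ω c := by
  cases t with
  | zero => exact (hD.L_zero ω c).1
  | succ t => rw [hD.L_succ]; exact le_min (le_max_right _ _) hLM

lemma IsCausal.arrivals_le_cap (hA : p.IsCausal P ℱ μM lam) (hD : p.IsDynamics net LM a ρ)
    (hLM : 0 ≤ LM) (t : ℕ) (ω : Ω) (c : Flow) : (p.A t ω c : ℝ) ≤ p.cap μM t ω c :=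
  le_min (by linarith [hD.L_nonneg hLM t ω c]) (hA.arrivals_bounded t ω c)

lemma IsDynamics.Us_nonneg (hD : p.IsDynamics net LM a ρ) (hC : p.IsControlled net qM μM η V ρ)
    (t : ℕ) (ω : Ω) (c : Flow) : 0 ≤ p.Us t ω c := by
  cases t with
  | zero => exact (hD.Us_zero ω c).ge
  | succ t => rw [hD.Us_succ]; exact add_nonneg (le_max_right _ _) (hC.R_mem t ω c).1

lemma IsDynamics.X_nonneg (hD : p.IsDynamics net LM a ρ) (t : ℕ) (ω : Ω) (c : Flow) :
    0 ≤ p.X t ω c := by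
  cases t with
  | zero => exact (hD.X_zero ω c).ge
  | succ t =>
    rw [hD.X_succ]
    exact add_nonneg (le_max_right _ _) (Finset.sum_nonneg fun _ _ => Nat.cast_nonneg _)

lemma IsDynamics.Z_nonneg (hD : p.IsDynamics net LM a ρ) (ha : ∀ c, 0 ≤ a c) (t : ℕ) (ω : Ω)
    (c : Flow) : 0 ≤ p.Z t ω c := by
  cases t with
  | zero => exact (hD.Z_zero ω c).ge
  | succ t => rw [hD.Z_succ]; exact add_nonneg (le_max_right _ _) (ha c)

lemma IsDynamics.Y_nonneg (hD : p.IsDynamics net LM a ρ) (hC : p.IsControlled net qM μM η V ρ)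
    (t : ℕ) (ω : Ω) (c : Flow) : 0 ≤ p.Y t ω c := by
  cases t with
  | zero => exact (hD.Y_zero ω c).ge
  | succ t => rw [hD.Y_succ]; exact add_nonneg (le_max_right _ _) (hC.v_mem t ω c).1

/-- The scheduling policy keeps the node backlogs below the threshold `q_M`. -/
lemma IsDynamics.U_le (hD : p.IsDynamics net LM a ρ) (hC : p.IsControlled net qM μM η V ρ)
    (hqM : 0 < qM) (t : ℕ) (ω : Ω) (c : Flow) (n : Node) : (p.U t ω c n : ℝ) ≤ qM := by
  induction t generalizing c n with
  | zero => simpa [hD.U_zero] using hqM.le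
  | succ t ih =>
    by_cases hn : n = net.dst c
    · simpa [hn, hD.U_dst] using hqM.le
    · have hs := hC.schedule t ω
      have h1 : (p.U (t + 1) ω c n : ℝ) ≤ (p.U t ω c n : ℝ) + ∑ j, (p.mu t ω c j n : ℝ)
          + (if n = net.src c then (p.adm t ω c : ℝ) else 0) := by
        have := (hD.U_succ t ω c n hn).trans
          (Nat.add_le_add_right (Nat.add_le_add_right (Nat.sub_le _ _) _) _)
        exact_mod_cast this
      -- Link arrivals and admissions never meet: no link feeds the source, and only the source
      -- admits.
      by_cases hb : n = net.src c
      · subst hb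
        have h2 : ∑ j, (p.mu t ω c j (net.src c) : ℝ) = 0 := by
          exact_mod_cast hs.feasible.activation.no_loop c
        rw [if_pos rfl, h2, add_zero] at h1
        exact h1.trans (hs.admit_le hqM (hD.Us_nonneg hC t ω) (p.cap_le μM t ω) c (ih c _))
      · rw [if_neg hb, add_zero] at h1
        exact h1.trans (hs.inflow_le hqM (hD.Us_nonneg hC t ω) c n (ih c))

lemma IsControlled.v_eq_zero (hC : p.IsControlled net qM μM η V ρ) {t : ℕ} {ω : Ω} {c : Flow}
    (h : V < η * p.Y t ω c) : p.v t ω c = 0 := by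
  have h0 := hC.v_mem t ω c
  have hmin := isMinOn_iff.1 (hC.v_min t ω c) 0 ⟨le_rfl, h0.1.trans h0.2⟩
  nlinarith [h0.1]

/-- The auxiliary queues stay below `V / η + μ_M`. -/
lemma IsDynamics.Y_le (hD : p.IsDynamics net LM a ρ) (hC : p.IsControlled net qM μM η V ρ)
    (hη : 0 < η) (hV : 0 ≤ V) (hμM : 0 ≤ μM) (t : ℕ) (ω : Ω) (c : Flow) :
    p.Y t ω c ≤ V / η + μM := by
  have hVη : 0 ≤ V / η := div_nonneg hV hη.le
  induction t with
  | zero => rw [hD.Y_zero]; exact add_nonneg hVη hμM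
  | succ t ih =>
    rw [hD.Y_succ]
    have hm : max (p.Y t ω c - p.R t ω c) 0 ≤ p.Y t ω c :=
      max_le (sub_le_self _ (hC.R_mem t ω c).1) (hD.Y_nonneg hC t ω c)
    -- Above `V / η` the controller stops the input; below, one slot adds at most `μM`.
    rcases lt_or_ge V (η * p.Y t ω c) with h | h
    · rw [hC.v_eq_zero h, add_zero]
      exact hm.trans ih
    · have : p.Y t ω c ≤ V / η := by rw [le_div_iff₀ hη]; linarith
      linarith [(hC.v_mem t ω c).2]

/-- The inputs of the auxiliary queues are the virtual input rates, up to the final backlog. -/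
lemma IsDynamics.sum_v_le (hD : p.IsDynamics net LM a ρ) (t : ℕ) (ω : Ω) (c : Flow) :
    ∑ τ ∈ Finset.range t, p.v τ ω c ≤ ∑ τ ∈ Finset.range t, p.R τ ω c + p.Y t ω c := by
  induction t with
  | zero => simp [hD.Y_zero]
  | succ t ih =>
    rw [Finset.sum_range_succ, Finset.sum_range_succ, hD.Y_succ]
    linarith [le_max_left (p.Y t ω c - p.R t ω c) 0]

end Bounds

/-! ### Adaptedness of the queues -/

section Measurability

lemma IsCausal.A_bdd (hA : p.IsCausal P ℱ μM lam) (t : ℕ) (c : Flow) :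
    IsBddMeasurable (ℱ (t + 1)) fun ω => (p.A t ω c : ℝ) :=
  .of_mem_Icc (measurable_from_nat.comp ((measurable_pi_apply c).comp (hA.meas_A t)))
    fun ω => ⟨Nat.cast_nonneg _, hA.arrivals_bounded t ω c⟩

lemma IsCausal.adm_bdd (hA : p.IsCausal P ℱ μM lam) (hC : p.IsControlled net qM μM η V ρ)
    (t : ℕ) (c : Flow) : IsBddMeasurable (ℱ (t + 1)) fun ω => (p.adm t ω c : ℝ) :=
  .of_mem_Icc (measurable_from_nat.comp ((measurable_pi_apply c).comp (hA.meas_adm t)))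
    fun ω => ⟨Nat.cast_nonneg _, hC.adm_le t ω c⟩

lemma IsCausal.R_bdd (hA : p.IsCausal P ℱ μM lam) (hC : p.IsControlled net qM μM η V ρ)
    (t : ℕ) (c : Flow) : IsBddMeasurable (ℱ (t + 1)) fun ω => p.R t ω c :=
  .of_mem_Icc ((measurable_pi_apply c).comp (hA.meas_R t))
    fun ω => ⟨(hC.R_mem t ω c).1, hC.R_le t ω c⟩

lemma IsCausal.v_bdd (hA : p.IsCausal P ℱ μM lam) (hC : p.IsControlled net qM μM η V ρ)
    (t : ℕ) (c : Flow) : IsBddMeasurable (ℱ (t + 1)) fun ω => p.v t ω c :=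
  .of_mem_Icc ((measurable_pi_apply c).comp (hA.meas_v t)) fun ω => hC.v_mem t ω c

lemma IsCausal.U_bdd (hA : p.IsCausal P ℱ μM lam) (hD : p.IsDynamics net LM a ρ)
    (hC : p.IsControlled net qM μM η V ρ) (hqM : 0 < qM) (t : ℕ) (c : Flow) (n : Node) :
    IsBddMeasurable (ℱ t) fun ω => (p.U t ω c n : ℝ) :=
  .of_mem_Icc (measurable_from_nat.comp
    ((measurable_pi_apply n).comp ((measurable_pi_apply c).comp (hA.meas_U t))))
    fun ω => ⟨Nat.cast_nonneg _, hD.U_le hC hqM t ω c n⟩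

/-- A queue with bounded, causal service and arrivals is bounded and adapted at every time. -/
lemma isBddMeasurable_queue {Q s f : ℕ → Ω → ℝ} (h0 : ∀ ω, Q 0 ω = 0)
    (hQ : ∀ t ω, Q (t + 1) ω = max (Q t ω - s t ω) 0 + f t ω)
    (hs : ∀ t, IsBddMeasurable (ℱ (t + 1)) (s t)) (hf : ∀ t, IsBddMeasurable (ℱ (t + 1)) (f t))
    (t : ℕ) : IsBddMeasurable (ℱ t) (Q t) := by
  induction t with
  | zero => rw [funext h0]; exact .const _ 0
  | succ t ih =>
    rw [funext (hQ t)]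
    exact ((ih.mono (ℱ.mono t.le_succ)).sub (hs t)).max_zero.add (hf t)

variable (hA : p.IsCausal P ℱ μM lam) (hD : p.IsDynamics net LM a ρ)
  (hC : p.IsControlled net qM μM η V ρ)
include hA hD hC

lemma IsCausal.Us_bdd (t : ℕ) (c : Flow) : IsBddMeasurable (ℱ t) fun ω => p.Us t ω c :=
  isBddMeasurable_queue (Q := fun t ω => p.Us t ω c) (fun ω => hD.Us_zero ω c)
    (fun t ω => hD.Us_succ t ω c) (fun t => hA.adm_bdd hC t c) (fun t => hA.R_bdd hC t c) t

lemma IsCausal.X_bdd (hqM : 0 < qM) (t : ℕ) (c : Flow) :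
    IsBddMeasurable (ℱ t) fun ω => p.X t ω c :=
  isBddMeasurable_queue (Q := fun t ω => p.X t ω c) (fun ω => hD.X_zero ω c)
    (fun t ω => hD.X_succ t ω c) (fun t => (hA.R_bdd hC t c).const_mul _)
    (fun t => .sum _ fun n => (hA.U_bdd hD hC hqM t c n).mono (ℱ.mono t.le_succ)) t

lemma IsCausal.Z_bdd (t : ℕ) (c : Flow) : IsBddMeasurable (ℱ t) fun ω => p.Z t ω c :=
  isBddMeasurable_queue (Q := fun t ω => p.Z t ω c) (fun ω => hD.Z_zero ω c)
    (fun t ω => hD.Z_succ t ω c) (fun t => hA.R_bdd hC t c) (fun _ => .const _ _) t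

lemma IsCausal.Y_bdd (t : ℕ) (c : Flow) : IsBddMeasurable (ℱ t) fun ω => p.Y t ω c :=
  isBddMeasurable_queue (Q := fun t ω => p.Y t ω c) (fun ω => hD.Y_zero ω c)
    (fun t ω => hD.Y_succ t ω c) (fun t => hA.R_bdd hC t c) (fun t => hA.v_bdd hC t c) t

end Measurability

/-! ### Independence of the arrivals from the past -/

section Independence

/-- Arrivals are uncorrelated with bounded functions of the past. -/
lemma IsCausal.integral_arrivals_mul [IsProbabilityMeasure P] (hA : p.IsCausal P ℱ μM lam)
    (t : ℕ) (c : Flow) {W : Ω → ℝ} (hW : IsBddMeasurable (ℱ t) W) :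
    ∫ ω, (p.A t ω c : ℝ) * W ω ∂P = lam c * ∫ ω, W ω ∂P := by
  have hind : IndepFun (fun ω => (p.A t ω c : ℝ)) W P := by
    refine (IndepFun_iff_Indep _ _ _).2
      (indep_of_indep_of_le_left (indep_of_indep_of_le_right (hA.arrivals_indep_past t) ?_) ?_)
    · exact hW.measurable.comap_le
    · have : (fun ω => (p.A t ω c : ℝ)) = (fun x : Flow → ℕ => (x c : ℝ)) ∘ p.A t := rfl
      rw [this, ← MeasurableSpace.comap_comp]
      exact MeasurableSpace.comap_mono (Measurable.comap_le (by fun_prop))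
  rw [hind.integral_fun_mul_eq_mul_integral
    ((hA.A_bdd t c).integrable (ℱ.le _)).aestronglyMeasurable
    (hW.integrable (ℱ.le _)).aestronglyMeasurable, hA.arrivals_mean]

end Independence

end Processes

/-! ### Pathwise drift of the Lyapunov function -/

section Drift

/-- The slack is `(u - s)² + 2ur` when the queue empties and `2sr` otherwise. -/
lemma sq_max_sub_add_le {u s r : ℝ} (hu : 0 ≤ u) (hs : 0 ≤ s) (hr : 0 ≤ r) :
    (max (u - s) 0 + r) ^ 2 ≤ u ^ 2 + s ^ 2 + r ^ 2 - 2 * u * (s - r) := by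
  rcases le_total (u - s) 0 with h | h
  · rw [max_eq_right h]
    nlinarith [mul_nonneg hu hr, sq_nonneg (u - s)]
  · rw [max_eq_left h]
    nlinarith [mul_nonneg hs hr]

lemma sq_le_of_le_sub_add {u' u o i : ℕ} (h : u' ≤ (u - o) + i) :
    (u' : ℝ) ^ 2 ≤ (u : ℝ) ^ 2 + (o : ℝ) ^ 2 + (i : ℝ) ^ 2 - 2 * u * (o - i) := by
  refine le_trans ?_
    (sq_max_sub_add_le (Nat.cast_nonneg u) (Nat.cast_nonneg o) (Nat.cast_nonneg i))
  have h1 : ((u - o : ℕ) : ℝ) ≤ max ((u : ℝ) - o) 0 := by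
    rcases le_total o u with h2 | h2
    · rw [Nat.cast_sub h2]; exact le_max_left _ _
    · simp [Nat.sub_eq_zero_of_le h2]
  have h2 : (u' : ℝ) ≤ ((u - o : ℕ) : ℝ) + i := by exact_mod_cast h
  gcongr
  linarith

namespace Processes

variable {Node Flow : Type*} [Fintype Node] [DecidableEq Node] [Fintype Flow]
  {Ω : Type*} [mΩ : MeasurableSpace Ω] {P : Measure Ω} {ℱ : Filtration ℕ mΩ}
  {p : Processes Node Flow Ω} {net : Network Node Flow} {qM μM η V LM : ℝ} {a ρ lam : Flow → ℝ}

/-- The Lyapunov function of flow `c`. -/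
def flowLyapunov (p : Processes Node Flow Ω) (qM μM η : ℝ) (t : ℕ) (ω : Ω) (c : Flow) : ℝ :=
  1 / 2 * ((qM - μM) / qM * p.Us t ω c ^ 2 + p.X t ω c ^ 2 + p.Z t ω c ^ 2 + η * p.Y t ω c ^ 2
    + 1 / qM * (p.Us t ω c * ∑ n, (p.U t ω c n : ℝ) ^ 2))

/-- The contribution of flow `c` to the drift bound. -/
def flowConst (Node : Type*) [Fintype Node] (qM μM η a ρ : ℝ) : ℝ :=
  1 / 2 * (Fintype.card Node : ℝ) * qM * μM + (qM - μM) / qM * μM ^ 2 + 1 / 2 * μM ^ 2 * ρ ^ 2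
    + 1 / 2 * (Fintype.card Node : ℝ) ^ 2 * qM ^ 2 + 1 / 2 * μM ^ 2 + 1 / 2 * a ^ 2 + η * μM ^ 2

lemma IsDynamics.sum_U_le (hD : p.IsDynamics net LM a ρ) (hC : p.IsControlled net qM μM η V ρ)
    (hqM : 0 < qM) (t : ℕ) (ω : Ω) (c : Flow) :
    ∑ n, (p.U t ω c n : ℝ) ≤ Fintype.card Node * qM := by
  refine (Finset.sum_le_card_nsmul _ _ qM fun n _ => hD.U_le hC hqM t ω c n).trans_eq ?_
  rw [nsmul_eq_mul, Finset.card_univ]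

/-- One-slot growth of the squared backlog of a node. -/
lemma IsDynamics.sq_U_succ_le (hD : p.IsDynamics net LM a ρ)
    (hC : p.IsControlled net qM μM η V ρ) (t : ℕ) (ω : Ω) (c : Flow) (n : Node) :
    (p.U (t + 1) ω c n : ℝ) ^ 2 ≤ (p.U t ω c n : ℝ) ^ 2
      + (1 + if n = net.src c then μM ^ 2 else 0)
      - 2 * ((p.U t ω c n : ℝ) * (∑ i, (p.mu t ω c n i : ℝ) - ∑ j, (p.mu t ω c j n : ℝ)))
      + 2 * ((p.U t ω c n : ℝ) * if n = net.src c then (p.adm t ω c : ℝ) else 0) := by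
  have hact := (hC.schedule t ω).feasible.activation
  have hμ : 0 ≤ μM := (hC.v_mem t ω c).1.trans (hC.v_mem t ω c).2
  by_cases hn : n = net.dst c
  · subst hn
    have : (0 : ℝ) ≤ if net.dst c = net.src c then μM ^ 2 else 0 := by split_ifs <;> positivity
    simp only [hD.U_dst]
    norm_num
    linarith
  · have h1 := hD.U_succ t ω c n hn
    rw [add_assoc] at h1
    have h2 := sq_le_of_le_sub_add h1
    push_cast at h2
    have h3 : ∑ i, p.mu t ω c n i + ∑ j, p.mu t ω c j n ≤ 1 :=
      (Finset.single_le_sum (f := fun c => ∑ i, p.mu t ω c n i + ∑ j, p.mu t ω c j n)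
        (fun _ _ => Nat.zero_le _) (Finset.mem_univ c)).trans (hact.exclusive n)
    have h4 : ∑ i, (p.mu t ω c n i : ℝ) + ∑ j, (p.mu t ω c j n : ℝ) ≤ 1 := by exact_mod_cast h3
    have ho : (0 : ℝ) ≤ ∑ i, (p.mu t ω c n i : ℝ) := Finset.sum_nonneg fun _ _ => Nat.cast_nonneg _
    have hi : (0 : ℝ) ≤ ∑ j, (p.mu t ω c j n : ℝ) := Finset.sum_nonneg fun _ _ => Nat.cast_nonneg _
    set o := ∑ i, (p.mu t ω c n i : ℝ)
    set i := ∑ j, (p.mu t ω c j n : ℝ) with hidef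
    -- As `o + i ≤ 1`, the squares contribute at most 1. At the source `i = 0`, so there is no cross
    -- term with the admissions, whose square adds at most `μM ^ 2`.
    by_cases hb : n = net.src c
    · have hi0 : i = 0 := by
        rw [hidef, hb]
        exact_mod_cast hact.no_loop c
      simp only [if_pos hb] at h2 ⊢
      rw [hi0] at h2 h4 ⊢
      have h5 := hC.adm_le t ω c
      have h6 : (p.adm t ω c : ℝ) ^ 2 ≤ μM ^ 2 := by gcongr
      nlinarith
    · simp only [if_neg hb, add_zero, mul_zero] at h2 ⊢
      nlinarith

/-- One-slot drift of the Lyapunov function of a flow. -/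
lemma IsDynamics.flowLyapunov_succ_le (hD : p.IsDynamics net LM a ρ)
    (hC : p.IsControlled net qM μM η V ρ) (hμq : μM < qM) (hη : 0 ≤ η)
    (ha : ∀ c, 0 ≤ a c) (hρ : ∀ c, 0 ≤ ρ c) (t : ℕ) (ω : Ω) (c : Flow) :
    p.flowLyapunov qM μM η (t + 1) ω c ≤ p.flowLyapunov qM μM η t ω c
      + flowConst Node qM μM η (a c) (ρ c)
      + (Fintype.card Node + μM ^ 2) / (2 * qM) * p.Us t ω c
      - (∑ m, ∑ n, (p.mu t ω c m n : ℝ) * flowWeight qM (p.Us t ω) (p.U t ω) c m n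
        + (p.adm t ω c : ℝ) * admitWeight net qM μM (p.Us t ω) (p.U t ω) c)
      + p.R t ω c * ((qM - μM) / qM * p.Us t ω c - η * p.Y t ω c - p.X t ω c * ρ c - p.Z t ω c)
      + η * p.Y t ω c * p.v t ω c + p.X t ω c * (Fintype.card Node * qM) + p.Z t ω c * a c := by
  have hμ : 0 ≤ μM := (hC.v_mem t ω c).1.trans (hC.v_mem t ω c).2
  have hqM : 0 < qM := hμ.trans_lt hμq
  have hα : 0 ≤ (qM - μM) / qM := div_nonneg (sub_nonneg.2 hμq.le) hqM.le
  have hU0 := hD.Us_nonneg hC t ω c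
  have hU1 := hD.Us_nonneg hC (t + 1) ω c
  have hX := hD.X_nonneg t ω c
  have hZ := hD.Z_nonneg ha t ω c
  have hY := hD.Y_nonneg hC t ω c
  have hR0 := (hC.R_mem t ω c).1
  have hR1 := hC.R_le t ω c
  have hv0 := (hC.v_mem t ω c).1
  have hv1 := (hC.v_mem t ω c).2
  have hm0 : (0 : ℝ) ≤ p.adm t ω c := Nat.cast_nonneg _
  have hm1 := hC.adm_le t ω c
  have hS0 : 0 ≤ ∑ n, (p.U t ω c n : ℝ) := Finset.sum_nonneg fun _ _ => Nat.cast_nonneg _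
  have hS1 := hD.sum_U_le hC hqM t ω c
  have hR2 : p.R t ω c ^ 2 ≤ μM ^ 2 := by gcongr
  have hv2 : p.v t ω c ^ 2 ≤ μM ^ 2 := by gcongr
  have hm2 : (p.adm t ω c : ℝ) ^ 2 ≤ μM ^ 2 := by gcongr
  have dUs := sq_max_sub_add_le hU0 hm0 hR0
  rw [← hD.Us_succ] at dUs
  have dUs' : p.Us (t + 1) ω c ^ 2 ≤ p.Us t ω c ^ 2 + 2 * μM ^ 2
      - 2 * p.Us t ω c * (p.adm t ω c - p.R t ω c) := by linarith
  have dUs'' := mul_le_mul_of_nonneg_left dUs' hα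
  have dX := sq_max_sub_add_le hX (mul_nonneg (hρ c) hR0) hS0
  rw [← hD.X_succ] at dX
  have dX1 : (ρ c * p.R t ω c) ^ 2 ≤ μM ^ 2 * ρ c ^ 2 := by
    rw [mul_pow, mul_comm]
    gcongr
  have dX2 : (∑ n, (p.U t ω c n : ℝ)) ^ 2 ≤ (Fintype.card Node : ℝ) ^ 2 * qM ^ 2 := by
    rw [← mul_pow]
    gcongr
  have dX3 := mul_le_mul_of_nonneg_left hS1 hX
  have dZ := sq_max_sub_add_le hZ hR0 (ha c)
  rw [← hD.Z_succ] at dZ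
  have dY := sq_max_sub_add_le hY hR0 hv0
  rw [← hD.Y_succ] at dY
  have dY' : p.Y (t + 1) ω c ^ 2 ≤ p.Y t ω c ^ 2 + 2 * μM ^ 2
      - 2 * p.Y t ω c * (p.R t ω c - p.v t ω c) := by linarith
  have dY'' := mul_le_mul_of_nonneg_left dY' hη
  have hUs : p.Us (t + 1) ω c ≤ p.Us t ω c + μM := by
    rw [hD.Us_succ]
    linarith [max_le (sub_le_self (p.Us t ω c) hm0) hU0]
  set N : ℝ := (Fintype.card Node : ℝ) with hN
  have hsq : ∑ n, (p.U (t + 1) ω c n : ℝ) ^ 2 ≤ N * qM ^ 2 := by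
    refine (Finset.sum_le_card_nsmul _ _ (qM ^ 2) fun n _ => ?_).trans_eq ?_
    · have := hD.U_le hC hqM (t + 1) ω c n
      gcongr
    · rw [nsmul_eq_mul, Finset.card_univ]
  have hsq0 : 0 ≤ ∑ n, (p.U (t + 1) ω c n : ℝ) ^ 2 := Finset.sum_nonneg fun _ _ => sq_nonneg _
  -- Summation by parts turns the net outflow at the nodes into backlog differences along the links,
  -- hence into `flowWeight`.
  have hflow := Finset.sum_le_sum fun n (_ : n ∈ Finset.univ) => hD.sq_U_succ_le hC t ω c n
  rw [Finset.sum_add_distrib, Finset.sum_sub_distrib, Finset.sum_add_distrib,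
    Finset.sum_add_distrib, ← Finset.mul_sum, ← Finset.mul_sum,
    ← sum_mul_sub_eq_sum_mul_netFlow] at hflow
  simp only [mul_ite, mul_zero, Finset.sum_ite_eq', Finset.mem_univ, if_true, Finset.sum_const,
    Finset.card_univ, nsmul_eq_mul, mul_one] at hflow
  rw [← hN] at hflow
  have hw : ∑ m, ∑ n, (p.mu t ω c m n : ℝ) * flowWeight qM (p.Us t ω) (p.U t ω) c m n =
      1 / qM * (p.Us t ω c *
        ∑ m, ∑ n, (p.mu t ω c m n : ℝ) * ((p.U t ω c m : ℝ) - (p.U t ω c n : ℝ))) := by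
    simp only [Finset.mul_sum, flowWeight]
    refine Finset.sum_congr rfl fun m _ => Finset.sum_congr rfl fun n _ => by ring
  -- One part of the admission weight comes from the square of `Us`, the other from the product
  -- term; this fixes the coefficient `(qM - μM) / qM` in the Lyapunov function.
  have ha' : admitWeight net qM μM (p.Us t ω) (p.U t ω) c =
      (qM - μM) / qM * p.Us t ω c - 1 / qM * (p.Us t ω c * p.U t ω c (net.src c)) := by
    rw [admitWeight]; ring
  -- Growth of the factor `Us` is paid for by the bound `qM` on the backlogs: after multiplication
  -- by `1 / (2 * qM)` it costs the constant `N * qM * μM / 2`. What remains has the old `Us` as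
  -- factor.
  have hcub : p.Us (t + 1) ω c * ∑ n, (p.U (t + 1) ω c n : ℝ) ^ 2 ≤ μM * (N * qM ^ 2)
      + p.Us t ω c * ∑ n, (p.U (t + 1) ω c n : ℝ) ^ 2 := by
    linarith [mul_le_mul_of_nonneg_right hUs hsq0, mul_le_mul_of_nonneg_left hsq hμ]
  have hcub2 := mul_le_mul_of_nonneg_left hflow hU0
  have hcub3 := mul_le_mul_of_nonneg_left (hcub.trans (add_le_add_right hcub2 _))
    (one_div_pos.2 hqM).le
  have e1 : 1 / qM * (μM * (N * qM ^ 2)) = N * qM * μM := by field_simp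
  have e2 : (N + μM ^ 2) / (2 * qM) * p.Us t ω c =
      1 / 2 * (1 / qM * (p.Us t ω c * (N + μM ^ 2))) := by
    field_simp
  rw [hw, ha', e2]
  simp only [flowLyapunov, flowConst, ← hN]
  rw [mul_add, e1] at hcub3
  clear hcub hcub2 hflow hw ha' e1 e2 hsq hUs dUs dUs' dY dY'
  generalize (qM - μM) / qM = α at *
  generalize 1 / qM = β at *
  linarith

end Processes

end Drift

/-! ### Expected drift against the comparison policy -/

section Expectation

namespace Processes

variable {Node Flow : Type*} [Fintype Node] [DecidableEq Node] [Fintype Flow]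
  {Ω : Type*} [mΩ : MeasurableSpace Ω] {P : Measure Ω} {ℱ : Filtration ℕ mΩ}
  {p : Processes Node Flow Ω} {net : Network Node Flow} {qM μM η V LM ε : ℝ}
  {a ρ lam r u : Flow → ℝ}

/-- The expected Lyapunov function. -/
def expLyapunov (p : Processes Node Flow Ω) (P : Measure Ω) (qM μM η : ℝ) (t : ℕ) : ℝ :=
  ∑ c, ∫ ω, p.flowLyapunov qM μM η t ω c ∂P

lemma expLyapunov_zero (hD : p.IsDynamics net LM a ρ) : p.expLyapunov P qM μM η 0 = 0 := by
  simp [expLyapunov, flowLyapunov, hD.Us_zero, hD.X_zero, hD.Z_zero, hD.Y_zero]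

lemma expLyapunov_nonneg (hD : p.IsDynamics net LM a ρ) (hC : p.IsControlled net qM μM η V ρ)
    (hqM : 0 < qM) (hμq : μM ≤ qM) (hη : 0 ≤ η) (t : ℕ) : 0 ≤ p.expLyapunov P qM μM η t := by
  refine Finset.sum_nonneg fun c _ => integral_nonneg fun ω => ?_
  have hα : 0 ≤ (qM - μM) / qM := div_nonneg (sub_nonneg.2 hμq) hqM.le
  have hUs := hD.Us_nonneg hC t ω c
  have hS : 0 ≤ ∑ n, (p.U t ω c n : ℝ) ^ 2 := Finset.sum_nonneg fun _ _ => sq_nonneg _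
  simp only [Pi.zero_apply, flowLyapunov]
  positivity

/-- The weight of the virtual input rate of flow `c` in the congestion controller. -/
def rateWeight (p : Processes Node Flow Ω) (qM μM η : ℝ) (ρ : Flow → ℝ) (t : ℕ) (ω : Ω)
    (c : Flow) : ℝ :=
  (qM - μM) / qM * p.Us t ω c - η * p.Y t ω c - p.X t ω c * ρ c - p.Z t ω c

/-- The part of the drift bound that the arrivals multiply. -/
def arrivalWeight (p : Processes Node Flow Ω) (net : Network Node Flow) (qM μM η : ℝ)
    (ρ lam r : Flow → ℝ) (t : ℕ) (ω : Ω) (c : Flow) : ℝ :=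
  r c / lam c * p.rateWeight qM μM η ρ t ω c
    - max (admitWeight net qM μM (p.Us t ω) (p.U t ω) c) 0

/-- The part of the drift bound that depends on the past only, when the auxiliary variable is
compared with `u c`. -/
def pastDrift (p : Processes Node Flow Ω) (net : Network Node Flow) (qM μM η V ε : ℝ)
    (a r u : Flow → ℝ) (t : ℕ) (ω : Ω) (c : Flow) : ℝ :=
  (Fintype.card Node + μM ^ 2) / (2 * qM) * p.Us t ω c
    - p.Us t ω c / qM * p.U t ω c (net.src c) * (r c + ε) + u c * (η * p.Y t ω c - V)
    + p.X t ω c * (Fintype.card Node * qM) + p.Z t ω c * a c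

/-- Pathwise drift-plus-penalty bound: the decisions are compared with a stationary policy that
serves the rates `r + ε`, whose virtual input rates are proportional to the arrivals. -/
lemma drift_plus_penalty_le (hA : p.IsCausal P ℱ μM lam) (hD : p.IsDynamics net LM a ρ)
    (hC : p.IsControlled net qM μM η V ρ) (hz : (fun c => r c + ε) ∈ capacityRegion net)
    (hLM : 0 ≤ LM) (hμq : μM < qM) (hη : 0 ≤ η) (ha : ∀ c, 0 ≤ a c) (hρ : ∀ c, 0 ≤ ρ c)
    (hr : ∀ c, 0 ≤ r c) (hlam : ∀ c, r c < lam c) (hu : ∀ c, u c ∈ Set.Icc 0 μM)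
    (t : ℕ) (ω : Ω) :
    ∑ c, p.flowLyapunov qM μM η (t + 1) ω c - V * ∑ c, p.v t ω c ≤
      ∑ c, p.flowLyapunov qM μM η t ω c + ∑ c, flowConst Node qM μM η (a c) (ρ c)
      + ∑ c, p.pastDrift net qM μM η V ε a r u t ω c
      + ∑ c, (p.A t ω c : ℝ) * p.arrivalWeight net qM μM η ρ lam r t ω c := by
  have hstep := Finset.sum_le_sum fun c (_ : c ∈ Finset.univ) =>
    hD.flowLyapunov_succ_le hC hμq hη ha hρ t ω c
  rcases isEmpty_or_nonempty Flow with hF | ⟨⟨c₀⟩⟩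
  · simp
  have hqM : 0 < qM := ((hu c₀).1.trans (hu c₀).2).trans_lt hμq
  -- All arrivals can be admitted, since they respect the cap.
  have hcap := (hC.schedule t ω).capacity_le hz hqM (hD.Us_nonneg hC t ω) (hD.U_dst t ω)
    (hA.arrivals_le_cap hD hLM t ω)
  -- Because `r < lam`, the rate `A * r / lam` stays below the cap; its mean is `r`.
  have hR : ∀ c, p.R t ω c * p.rateWeight qM μM η ρ t ω c ≤
      (p.A t ω c : ℝ) * (r c / lam c) * p.rateWeight qM μM η ρ t ω c := by
    intro c
    have hl : 0 < lam c := (hr c).trans_lt (hlam c)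
    have h0 : 0 ≤ r c / lam c := div_nonneg (hr c) hl.le
    have h1 : r c / lam c ≤ 1 := (div_le_one hl).2 (hlam c).le
    have hA0 : (0 : ℝ) ≤ p.A t ω c := Nat.cast_nonneg _
    exact isMinOn_iff.1 (hC.R_min t ω c) _ ⟨mul_nonneg hA0 h0,
      (mul_le_of_le_one_right hA0 h1).trans (hA.arrivals_le_cap hD hLM t ω c)⟩
  have hv : ∀ c, p.v t ω c * (η * p.Y t ω c - V) ≤ u c * (η * p.Y t ω c - V) := fun c =>
    isMinOn_iff.1 (hC.v_min t ω c) (u c) (hu c)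
  have hcmp : ∑ c, (p.flowLyapunov qM μM η t ω c + flowConst Node qM μM η (a c) (ρ c)
      + (Fintype.card Node + μM ^ 2) / (2 * qM) * p.Us t ω c
      + p.R t ω c * p.rateWeight qM μM η ρ t ω c
      + (η * p.Y t ω c * p.v t ω c - V * p.v t ω c)
      + p.X t ω c * (Fintype.card Node * qM) + p.Z t ω c * a c) ≤
      ∑ c, (p.flowLyapunov qM μM η t ω c + flowConst Node qM μM η (a c) (ρ c)
      + (p.pastDrift net qM μM η V ε a r u t ω c
        + p.Us t ω c / qM * p.U t ω c (net.src c) * (r c + ε))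
      + ((p.A t ω c : ℝ) * p.arrivalWeight net qM μM η ρ lam r t ω c
        + (p.A t ω c : ℝ) * max (admitWeight net qM μM (p.Us t ω) (p.U t ω) c) 0)) := by
    refine Finset.sum_le_sum fun c _ => ?_
    rw [pastDrift, arrivalWeight]
    linarith [hR c, hv c]
  simp only [← rateWeight.eq_1] at hstep
  simp only [Finset.sum_add_distrib, Finset.sum_sub_distrib, ← Finset.mul_sum] at hstep hcmp ⊢
  linarith

/-- Averaging the arrivals turns the comparison policy into negative drift in all the queues. -/
lemma pastDrift_add_le (p : Processes Node Flow Ω) (net : Network Node Flow) (V : ℝ)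
    (a ρ u : Flow → ℝ) (t : ℕ) (ω : Ω) {c : Flow} (hr : 0 ≤ r c) (hε : 0 ≤ ε)
    (hlam : r c + ε < lam c) :
    p.pastDrift net qM μM η V ε a r u t ω c
      + lam c * p.arrivalWeight net qM μM η ρ lam r t ω c ≤
    -(((qM - μM) / qM * ε - (Fintype.card Node + μM ^ 2) / (2 * qM)) * p.Us t ω c
      + (ρ c * r c - Fintype.card Node * qM) * p.X t ω c + (r c - a c) * p.Z t ω c
      + η * (r c - u c) * p.Y t ω c + V * u c) := by
  have hl : lam c ≠ 0 := by linarith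
  have hw0 := le_max_right (admitWeight net qM μM (p.Us t ω) (p.U t ω) c) 0
  have hw1 := le_max_left (admitWeight net qM μM (p.Us t ω) (p.U t ω) c) 0
  -- The surplus `lam > r + ε` is used here. The source backlog then cancels against the term from
  -- weak duality, leaving `(qM - μM) / qM * ε` as drift in `Us`.
  have hw : (r c + ε) * admitWeight net qM μM (p.Us t ω) (p.U t ω) c ≤
      lam c * max (admitWeight net qM μM (p.Us t ω) (p.U t ω) c) 0 :=
    (mul_le_mul_of_nonneg_left hw1 (by linarith)).trans (mul_le_mul_of_nonneg_right hlam.le hw0)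
  have hsplit : admitWeight net qM μM (p.Us t ω) (p.U t ω) c =
      (qM - μM) / qM * p.Us t ω c - p.Us t ω c / qM * p.U t ω c (net.src c) := by
    rw [admitWeight]; ring
  have hrate : lam c * (r c / lam c * p.rateWeight qM μM η ρ t ω c) =
      r c * p.rateWeight qM μM η ρ t ω c := by
    field_simp
  rw [arrivalWeight, mul_sub, hrate, rateWeight, pastDrift]
  rw [hsplit] at hw ⊢
  generalize (qM - μM) / qM = α at *
  generalize p.Us t ω c / qM = β at *
  linarith

section

variable (hA : p.IsCausal P ℱ μM lam) (hD : p.IsDynamics net LM a ρ)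
  (hC : p.IsControlled net qM μM η V ρ)
include hA hD hC

lemma IsCausal.flowLyapunov_bdd (hqM : 0 < qM) (t : ℕ) (c : Flow) :
    IsBddMeasurable (ℱ t) fun ω => p.flowLyapunov qM μM η t ω c :=
  (((((((hA.Us_bdd hD hC t c).pow 2).const_mul _).add ((hA.X_bdd hD hC hqM t c).pow 2)).add
    ((hA.Z_bdd hD hC t c).pow 2)).add (((hA.Y_bdd hD hC t c).pow 2).const_mul _)).add
    (((hA.Us_bdd hD hC t c).mul
      (.sum _ fun n => (hA.U_bdd hD hC hqM t c n).pow 2)).const_mul _)).const_mul _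

lemma IsCausal.arrivalWeight_bdd (hqM : 0 < qM) (t : ℕ) (c : Flow) :
    IsBddMeasurable (ℱ t) fun ω => p.arrivalWeight net qM μM η ρ lam r t ω c := by
  have hUs := hA.Us_bdd hD hC t c
  refine IsBddMeasurable.sub (.const_mul _ ?_) (.max_zero ?_)
  · exact (((hUs.const_mul _).sub ((hA.Y_bdd hD hC t c).const_mul _)).sub
      ((hA.X_bdd hD hC hqM t c).mul (.const _ _))).sub (hA.Z_bdd hD hC t c)
  · simp only [admitWeight, div_eq_mul_inv]
    exact (hUs.mul (.const _ _)).mul ((IsBddMeasurable.const _ _).sub (hA.U_bdd hD hC hqM t c _))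

lemma IsCausal.pastDrift_bdd (hqM : 0 < qM) (t : ℕ) (c : Flow) :
    IsBddMeasurable (ℱ t) fun ω => p.pastDrift net qM μM η V ε a r u t ω c := by
  have hUs := hA.Us_bdd hD hC t c
  simp only [pastDrift, div_eq_mul_inv]
  exact ((((hUs.const_mul _).sub (((hUs.mul (.const _ _)).mul (hA.U_bdd hD hC hqM t c _)).mul
    (.const _ _))).add ((((hA.Y_bdd hD hC t c).const_mul _).sub (.const _ _)).const_mul _)).add
    ((hA.X_bdd hD hC hqM t c).mul (.const _ _))).add ((hA.Z_bdd hD hC t c).mul (.const _ _))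

/-- Expected drift-plus-penalty bound. -/
lemma IsCausal.expLyapunov_succ_le [IsProbabilityMeasure P]
    (hz : (fun c => r c + ε) ∈ capacityRegion net)
    (hLM : 0 ≤ LM) (hqM : 0 < qM) (hμq : μM < qM) (hη : 0 ≤ η) (ha : ∀ c, 0 ≤ a c)
    (hρ : ∀ c, 0 ≤ ρ c) (hε : 0 ≤ ε) (hr : ∀ c, 0 ≤ r c) (hlam : ∀ c, r c + ε < lam c)
    (hu : ∀ c, u c ∈ Set.Icc 0 μM) {g : Flow → Ω → ℝ} {t : ℕ} (hg : ∀ c, Integrable (g c) P)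
    (hle : ∀ c ω, g c ω ≤
      ((qM - μM) / qM * ε - (Fintype.card Node + μM ^ 2) / (2 * qM)) * p.Us t ω c
      + (ρ c * r c - Fintype.card Node * qM) * p.X t ω c + (r c - a c) * p.Z t ω c
      + η * (r c - u c) * p.Y t ω c + V * u c) :
    p.expLyapunov P qM μM η (t + 1) ≤ p.expLyapunov P qM μM η t
      + ∑ c, flowConst Node qM μM η (a c) (ρ c) + V * ∑ c, ∫ ω, p.v t ω c ∂P
      - ∑ c, ∫ ω, g c ω ∂P := by
  have iLy := fun t c => (hA.flowLyapunov_bdd hD hC hqM t c).integrable (P := P) (ℱ.le t)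
  have iv := fun c => (hA.v_bdd hC t c).integrable (P := P) (ℱ.le _)
  have bW := fun c => hA.arrivalWeight_bdd hD hC (r := r) hqM t c
  have iF := fun c => (hA.pastDrift_bdd hD hC (ε := ε) (r := r) (u := u) hqM t c).integrable
    (P := P) (ℱ.le _)
  have iAW := fun c => ((hA.A_bdd t c).mul ((bW c).mono (ℱ.mono t.le_succ))).integrable
    (P := P) (ℱ.le _)
  have hpath := fun ω => drift_plus_penalty_le hA hD hC hz hLM hμq hη ha hρ hr
    (fun c => (le_add_of_nonneg_right hε).trans_lt (hlam c)) hu t ω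
  have i1 := integrable_finsetSum Finset.univ fun c _ => iLy t c
  have i2 := integrable_finsetSum Finset.univ fun c _ => iLy (t + 1) c
  have i3 := (integrable_finsetSum Finset.univ fun c _ => iv c).const_mul V
  have i4 := integrable_finsetSum Finset.univ fun c _ => iF c
  have i5 := integrable_finsetSum Finset.univ fun c _ => iAW c
  have ic := integrable_const (μ := P) (∑ c, flowConst Node qM μM η (a c) (ρ c))
  have hmono := integral_mono (i2.sub i3) (((i1.add ic).add i4).add i5) hpath
  have e1 := integral_sub i2 i3
  have e2 := integral_add ((i1.add ic).add i4) i5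
  have e3 := integral_add (i1.add ic) i4
  have e4 := integral_add i1 ic
  have s1 := integral_finsetSum Finset.univ fun c _ => iLy t c
  have s2 := integral_finsetSum Finset.univ fun c _ => iLy (t + 1) c
  have s3 := integral_finsetSum Finset.univ fun c _ => iv c
  have s4 := integral_finsetSum Finset.univ fun c _ => iF c
  have s5 := integral_finsetSum Finset.univ fun c _ => iAW c
  have hdrift : ∑ c, ∫ ω, p.pastDrift net qM μM η V ε a r u t ω c ∂P
      + ∑ c, ∫ ω, (p.A t ω c : ℝ) * p.arrivalWeight net qM μM η ρ lam r t ω c ∂P ≤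
      -∑ c, ∫ ω, g c ω ∂P := by
    rw [← Finset.sum_add_distrib, ← Finset.sum_neg_distrib]
    refine Finset.sum_le_sum fun c _ => ?_
    have iW := ((bW c).integrable (P := P) (ℱ.le t)).const_mul (lam c)
    -- Independence replaces the arrivals by their means, as the other factor is known before the
    -- slot.
    rw [hA.integral_arrivals_mul t c (bW c), ← integral_const_mul, ← integral_add (iF c) iW,
      ← integral_neg]
    refine integral_mono ((iF c).add iW) (hg c).neg fun ω => ?_
    exact (pastDrift_add_le p net V a ρ u t ω (hr c) hε (hlam c)).trans (neg_le_neg (hle c ω))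
  simp only [Pi.add_apply, Pi.sub_apply, integral_const_mul, integral_const, probReal_univ,
    one_smul] at hmono e1 e2 e3 e4
  rw [s3] at e1
  simp only [expLyapunov]
  linarith

end

end Processes

/-- Equality fails only in the last term of `constB`, which has `K * ∑ a²` in place of `∑ a²`. -/
lemma sum_flowConst_le (Node : Type*) {Flow : Type*} [Fintype Node] [Fintype Flow]
    (qM μM η : ℝ) (a ρ : Flow → ℝ) :
    ∑ c, Processes.flowConst Node qM μM η (a c) (ρ c) ≤ constB₁ Node qM μM η a ρ := by
  have h : ∑ c, a c ^ 2 ≤ (Fintype.card Flow : ℝ) * ∑ c, a c ^ 2 := by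
    rcases isEmpty_or_nonempty Flow with hF | hF
    · simp
    · refine le_mul_of_one_le_left (Finset.sum_nonneg fun _ _ => sq_nonneg _) ?_
      exact_mod_cast Fintype.card_pos
  simp only [Processes.flowConst, constB₁, constB, Finset.sum_add_distrib, ← Finset.mul_sum,
    Finset.sum_const, Finset.card_univ, nsmul_eq_mul]
  linarith

end Expectation

/-! ### From one-slot bounds to time averages -/

lemma exists_pos_forall_le {ι : Type*} [Finite ι] {f : ι → ℝ} (hf : ∀ i, 0 < f i) :
    ∃ δ : ℝ, 0 < δ ∧ ∀ i, δ ≤ f i := by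
  rcases isEmpty_or_nonempty ι with h | h
  · exact ⟨1, one_pos, fun i => h.elim i⟩
  · obtain ⟨i₀, h₀⟩ := Finite.exists_min f
    exact ⟨f i₀, hf i₀, h₀⟩

/-- Telescoping a one-step bound for a nonnegative sequence started at zero. -/
lemma sum_nonneg_of_succ_le {l x : ℕ → ℝ} (h0 : l 0 = 0) (hl : ∀ t, 0 ≤ l t)
    (h : ∀ t, l (t + 1) ≤ l t + x t) (T : ℕ) : 0 ≤ ∑ t ∈ Finset.range T, x t := by
  refine (hl T).trans ?_
  induction T with
  | zero => simp [h0]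
  | succ T ih => rw [Finset.sum_range_succ]; linarith [h T]

/-- The queue backlogs average at most `(B + V b) / δ` if the penalties average at most as much as
`f`, whose averages are asymptotically at most `b`. -/
lemma limsup_timeAvg_le {q w f : ℕ → ℝ} {B V b δ C : ℝ} (hδ : 0 < δ) (hV : 0 < V)
    (hq : ∀ T, δ * ∑ t ∈ Finset.range T, q t ≤ T * B + V * ∑ t ∈ Finset.range T, w t)
    (hw : ∀ T, ∑ t ∈ Finset.range T, w t ≤ ∑ t ∈ Finset.range T, f t + C)
    (hf : limsup (fun t => ((timeAvg f t : ℝ) : EReal)) atTop ≤ (b : EReal)) :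
    limsup (fun t => ((timeAvg q t : ℝ) : EReal)) atTop ≤ (((B + V * b) / δ : ℝ) : EReal) := by
  refine EReal.le_of_forall_lt_iff_le.1 fun z hz => ?_
  rw [EReal.coe_lt_coe_iff, div_lt_iff₀ hδ] at hz
  -- The margin is split in two: one `e` for the `limsup` of `f`, one for `C / T`.
  obtain ⟨e, he, hez⟩ : ∃ e : ℝ, 0 < e ∧ B + V * (b + 2 * e) ≤ z * δ :=
    ⟨(z * δ - (B + V * b)) / (2 * V), div_pos (by linarith) (by linarith), by
      field_simp
      linarith⟩
  have hfe : ∀ᶠ t in atTop, ((timeAvg f t : ℝ) : EReal) < ((b + e : ℝ) : EReal) :=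
    eventually_lt_of_limsup_lt (hf.trans_lt (EReal.coe_lt_coe_iff.2 (by linarith)))
  refine limsup_le_of_le (h := ?_)
  filter_upwards [hfe, eventually_gt_atTop 0,
    tendsto_natCast_atTop_atTop.eventually_ge_atTop (C / e)] with T hT hT0 hTC
  have hT0' : (0 : ℝ) < T := by exact_mod_cast hT0
  rw [EReal.coe_lt_coe_iff, timeAvg, one_div, inv_mul_lt_iff₀ hT0'] at hT
  rw [div_le_iff₀ he] at hTC
  rw [EReal.coe_le_coe_iff, timeAvg, one_div, inv_mul_le_iff₀ hT0']
  have h1 : ∑ t ∈ Finset.range T, w t ≤ T * (b + 2 * e) := by linarith [hw T]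
  have h2 := mul_le_mul_of_nonneg_left h1 hV.le
  have h3 := mul_le_mul_of_nonneg_left hez hT0'.le
  refine le_of_mul_le_mul_left ?_ hδ
  linarith [hq T]

namespace Processes

variable {Node Flow : Type*} [Fintype Node] [DecidableEq Node] [Fintype Flow]
  {Ω : Type*} [mΩ : MeasurableSpace Ω] {P : Measure Ω} {ℱ : Filtration ℕ mΩ}
  {p : Processes Node Flow Ω} {net : Network Node Flow} {qM μM η V LM : ℝ}
  {a ρ lam : Flow → ℝ}

/-- With `r + ε < lam` this places `r` in the range `[0, μM]` of the auxiliary variables. -/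
lemma IsCausal.mean_le [IsProbabilityMeasure P] (hA : p.IsCausal P ℱ μM lam) (c : Flow) :
    lam c ≤ μM := by
  rw [← hA.arrivals_mean 0 c]
  have h := integral_mono ((hA.A_bdd 0 c).integrable (P := P) (ℱ.le _))
    (integrable_const μM) fun ω => hA.arrivals_bounded 0 ω c
  simpa using h

/-- In expectation, the auxiliary variables exceed the virtual input rates by a bounded amount. -/
lemma IsCausal.sum_integral_v_le [IsProbabilityMeasure P] (hA : p.IsCausal P ℱ μM lam)
    (hD : p.IsDynamics net LM a ρ) (hC : p.IsControlled net qM μM η V ρ)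
    (hη : 0 < η) (hV : 0 ≤ V) (hμM : 0 ≤ μM) (T : ℕ) :
    ∑ t ∈ Finset.range T, ∑ c, ∫ ω, p.v t ω c ∂P ≤
      ∑ t ∈ Finset.range T, ∑ c, ∫ ω, p.R t ω c ∂P + ∑ _c : Flow, (V / η + μM) := by
  have iv := fun t c => (hA.v_bdd hC t c).integrable (P := P) (ℱ.le _)
  have iR := fun t c => (hA.R_bdd hC t c).integrable (P := P) (ℱ.le _)
  rw [Finset.sum_comm, Finset.sum_comm (s := Finset.range T), ← Finset.sum_add_distrib]
  refine Finset.sum_le_sum fun c _ => ?_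
  have hi := integrable_finsetSum (Finset.range T) fun t _ => iR t c
  have hc := integrable_const (μ := P) (V / η + μM)
  have h := integral_mono (integrable_finsetSum (Finset.range T) fun t _ => iv t c) (hi.add hc)
    fun ω => (hD.sum_v_le T ω c).trans
      (add_le_add_right (hD.Y_le hC hη hV hμM T ω c) _)
  have e := integral_add hi hc
  simp only [Pi.add_apply] at h e
  rwa [e, integral_finsetSum _ fun t _ => iv t c, integral_finsetSum _ fun t _ => iR t c,
    integral_const, probReal_univ, one_smul] at h

end Processes

end MultiHop

end

/-! ### The main theorem -/

theorem theorem3 {Node Flow : Type*} [Fintype Node] [DecidableEq Node] [Fintype Flow]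
    (net : MultiHop.Network Node Flow)
    (μM qM ε ε' η : ℝ) (a ρ r : Flow → ℝ)
    (hμM : 1 ≤ μM) (hε : 0 < ε) (hε' : 0 < ε') (hη : 0 < η)
    (ha : ∀ c, 0 ≤ a c)
    (hr : MultiHop.IsOptimalRate net a ε r)
    (hra : ∀ c, a c + ε' ≤ r c)
    (hq : (2 * (Fintype.card Node : ℝ) - 1 + μM ^ 2) / (2 * ε) + μM < qM)
    (hρ : ∀ c, (Fintype.card Node : ℝ) * qM / r c < ρ c) :
    ∃ δ' : ℝ, 0 < δ' ∧
      ∀ (V LM : ℝ) (lam : Flow → ℝ), 0 < V → 0 ≤ LM → (∀ c, r c + ε < lam c) →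
      ∀ (Ω : Type*) [mΩ : MeasurableSpace Ω] (P : Measure Ω) [IsProbabilityMeasure P]
        (ℱ : Filtration ℕ mΩ) (p : MultiHop.Processes Node Flow Ω),
        p.IsCausal P ℱ μM lam → p.IsDynamics net LM a ρ → p.IsControlled net qM μM η V ρ →
        (∀ t c, Integrable (fun ω => p.Us t ω c + p.X t ω c + p.Z t ω c + p.Y t ω c) P ∧
          Integrable (fun ω => p.R t ω c) P ∧ Integrable (fun ω => p.v t ω c) P) ∧
        (∀ BR : ℝ,
          limsup (fun t => ((MultiHop.timeAvg (fun τ => ∑ c, ∫ ω, p.R τ ω c ∂P) t : ℝ) : EReal))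
            atTop ≤ (BR : EReal) →
          limsup (fun t => ((MultiHop.timeAvg (fun τ => ∑ c,
              ∫ ω, (p.Us τ ω c + p.X τ ω c + p.Z τ ω c + p.Y τ ω c) ∂P) t : ℝ) : EReal)) atTop
            ≤ ((MultiHop.constB₂ Node qM μM η V BR a ρ / δ' : ℝ) : EReal)) ∧
        ((∑ c, r c - MultiHop.constB₁ Node qM μM η a ρ / V : ℝ) : EReal) ≤
          liminf (fun t => ((MultiHop.timeAvg (fun τ => ∑ c, ∫ ω, p.v τ ω c ∂P) t : ℝ) : EReal))
            atTop := by
  have hN0 : (0 : ℝ) ≤ Fintype.card Node := Nat.cast_nonneg _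
  have hr0 : ∀ c, 0 < r c := fun c => by linarith [ha c, hra c]
  have hμq : μM < qM := lt_of_le_of_lt (le_add_of_nonneg_left
    (div_nonneg (by nlinarith) (by linarith))) hq
  have hqM : 0 < qM := by linarith
  have hρ0 : ∀ c, 0 ≤ ρ c := fun c =>
    (div_nonneg (mul_nonneg hN0 hqM.le) (hr0 c).le).trans (hρ c).le
  -- A flow is needed to have a node: `N ≥ 1` gives `2 * N - 1 ≥ N`, so the hypothesis on `qM`
  -- suffices.
  have hd1 : ∀ _ : Flow, 0 < (qM - μM) / qM * ε
      - ((Fintype.card Node : ℝ) + μM ^ 2) / (2 * qM) := by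
    intro c
    have hN1 : (1 : ℝ) ≤ Fintype.card Node := by
      exact_mod_cast Fintype.card_pos_iff.2 ⟨net.src c⟩
    rw [← lt_sub_iff_add_lt, div_lt_iff₀ (by linarith)] at hq
    rw [sub_pos, div_lt_iff₀ (by linarith)]
    field_simp
    linarith
  have hd2 : ∀ c, 0 < ρ c * r c - Fintype.card Node * qM := fun c => by
    have := hρ c
    rw [div_lt_iff₀ (hr0 c)] at this
    linarith
  -- These are the drift coefficients of `Us`, `X`, `Z` and `Y` for `u = 0`, with `ε'` as a lower
  -- bound for `r - a`.
  obtain ⟨δ, hδ, hδle⟩ := MultiHop.exists_pos_forall_le (f := fun c => min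
    (min ((qM - μM) / qM * ε - ((Fintype.card Node : ℝ) + μM ^ 2) / (2 * qM))
      (ρ c * r c - Fintype.card Node * qM)) (min ε' (η * r c)))
    fun c => lt_min (lt_min (hd1 c) (hd2 c)) (lt_min hε' (mul_pos hη (hr0 c)))
  refine ⟨δ, hδ, fun V LM lam hV hLM hlam Ω mΩ P _ ℱ p hA hD hC => ?_⟩
  have bUs := hA.Us_bdd hD hC
  have bX := hA.X_bdd hD hC hqM
  have bZ := hA.Z_bdd hD hC
  have bY := hA.Y_bdd hD hC
  have iQ : ∀ t c, Integrable (fun ω => p.Us t ω c + p.X t ω c + p.Z t ω c + p.Y t ω c) P :=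
    fun t c => ((((bUs t c).add (bX t c)).add (bZ t c)).add (bY t c)).integrable (ℱ.le t)
  have hrμ : ∀ c, r c ∈ Set.Icc 0 μM := fun c =>
    ⟨(hr0 c).le, by linarith [hlam c, hA.mean_le c]⟩
  have hμ0 : 0 ≤ μM := by linarith
  have hB := MultiHop.sum_flowConst_le Node qM μM η a ρ
  have hstep := fun (u : Flow → ℝ) hu g t => hA.expLyapunov_succ_le hD hC (u := u) (g := g) (t := t)
    hr.1.1 hLM hqM hμq hη.le ha hρ0 hε.le (fun c => (hr0 c).le) hlam hu
  have hL0 := MultiHop.Processes.expLyapunov_zero (P := P) (qM := qM) (μM := μM) (η := η) hD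
  have hL := MultiHop.Processes.expLyapunov_nonneg (P := P) hD hC hqM hμq.le hη.le
  refine ⟨fun t c => ⟨iQ t c, (hA.R_bdd hC t c).integrable (ℱ.le _),
    (hA.v_bdd hC t c).integrable (ℱ.le _)⟩, fun BR hBR => ?_, ?_⟩
  · have hq' : ∀ t, p.expLyapunov P qM μM η (t + 1) ≤ p.expLyapunov P qM μM η t +
        (MultiHop.constB₁ Node qM μM η a ρ + V * ∑ c, ∫ ω, p.v t ω c ∂P - δ *
          ∑ c, ∫ ω, (p.Us t ω c + p.X t ω c + p.Z t ω c + p.Y t ω c) ∂P) := by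
      intro t
      -- With `u = 0` the queue `Y` has drift coefficient `η * r`, and all four queues are kept in
      -- `g`.
      have h := hstep (fun _ => 0) (fun _ => ⟨le_rfl, hμ0⟩)
        (fun c ω => δ * (p.Us t ω c + p.X t ω c + p.Z t ω c + p.Y t ω c)) t
        (fun c => (iQ t c).const_mul δ) fun c ω => ?_
      · simp only [integral_const_mul, ← Finset.mul_sum] at h
        linarith
      · have h1 := le_min_iff.1 (hδle c)
        have h2 := le_min_iff.1 h1.1
        have h3 := le_min_iff.1 h1.2
        have hZ : δ ≤ r c - a c := by linarith [hra c]
        have hY : δ ≤ η * (r c - 0) := by rw [sub_zero]; exact h3.2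
        have k1 := mul_le_mul_of_nonneg_right h2.1 (hD.Us_nonneg hC t ω c)
        have k2 := mul_le_mul_of_nonneg_right h2.2 (hD.X_nonneg t ω c)
        have k3 := mul_le_mul_of_nonneg_right hZ (hD.Z_nonneg ha t ω c)
        have k4 := mul_le_mul_of_nonneg_right hY (hD.Y_nonneg hC t ω c)
        linarith
    have hcoe : MultiHop.constB₂ Node qM μM η V BR a ρ =
      MultiHop.constB₁ Node qM μM η a ρ + V * BR := rfl
    rw [hcoe]
    refine MultiHop.limsup_timeAvg_le hδ hV (fun T => ?_)
      (hA.sum_integral_v_le hD hC hη hV.le hμ0) hBR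
    have h := MultiHop.sum_nonneg_of_succ_le hL0 hL hq' T
    rw [Finset.sum_sub_distrib, Finset.sum_add_distrib, Finset.sum_const, Finset.card_range,
      nsmul_eq_mul, ← Finset.mul_sum, ← Finset.mul_sum] at h
    linarith
  · have hv' : ∀ t, p.expLyapunov P qM μM η (t + 1) ≤ p.expLyapunov P qM μM η t +
        (MultiHop.constB₁ Node qM μM η a ρ + V * ∑ c, ∫ ω, p.v t ω c ∂P - V * ∑ c, r c) := by
      intro t
      -- With `u = r` the term in `Y` vanishes, the other queue terms are nonnegative and dropped,
      -- and only `V * r` is kept.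
      have h := hstep r hrμ (fun c _ => V * r c) t (fun c => integrable_const _) fun c ω => ?_
      · simp only [integral_const, probReal_univ, one_smul, ← Finset.mul_sum] at h
        linarith
      · have k1 := mul_nonneg (hd1 c).le (hD.Us_nonneg hC t ω c)
        have k2 := mul_nonneg (hd2 c).le (hD.X_nonneg t ω c)
        have k3 := mul_nonneg (by linarith [hra c] : 0 ≤ r c - a c) (hD.Z_nonneg ha t ω c)
        rw [sub_self, mul_zero, zero_mul]
        linarith
    -- The bound holds for every positive `T`, not only in the limit.
    refine le_liminf_of_le (h := ?_)
    filter_upwards [eventually_gt_atTop 0] with T hT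
    have hT' : (0 : ℝ) < T := by exact_mod_cast hT
    have h := MultiHop.sum_nonneg_of_succ_le hL0 hL hv' T
    rw [Finset.sum_sub_distrib, Finset.sum_add_distrib, Finset.sum_const, Finset.sum_const,
      Finset.card_range, nsmul_eq_mul, nsmul_eq_mul, ← Finset.mul_sum] at h
    rw [EReal.coe_le_coe_iff, MultiHop.timeAvg, one_div, le_inv_mul_iff₀ hT']
    refine le_of_mul_le_mul_left ?_ hV
    have e : V * (T * (∑ c, r c - MultiHop.constB₁ Node qM μM η a ρ / V)) =
        T * (V * ∑ c, r c) - T * MultiHop.constB₁ Node qM μM η a ρ := by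
      field_simp
    linarith
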